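/- Let $(K,<)$ be a (totally) ordered field. Its natural valuation $v$ sends $a\in K$ to its archimedean class, where $a,b$ are archimedean equivalent if $n|a|\ge |b|$ and $n|b|\ge |a|$ for some $n\in\mathbb N$, and the classes are ordered by $va\le vb$ if and only if $|a|\le n|b|$ for some $n\in\mathbb N$. The ultrametric balls of $K$ are the sets $B_u(x,y)=\{z\in K : v(x-z)\le v(x-y)\}$ with $x,y\in K$, and for $q,r\in\mathbb Q$ with $r>0$ the order ball with center $q$ and radius $r$ is $B_o(q;r)=\{z\in K : |q-z|\le r\}$. The hybrid ball space of $(K,<)$ is $K$ together with the set of balls $$\mathcal B_h(K,<)=\{B_u(x,y) : x,y\in K\}\cup\{B_o(q;r) : q,r\in\mathbb Q,\ r>0\}.$$ It is called spherically complete if every nonempty collection of these balls that is totally ordered by inclusion has a nonempty intersection. Theorem. The ordered field $(K,<)$ is isomorphic, as an ordered field, to a power series field $\mathbb R((t^\Gamma))$ for some (possibly trivial) totally ordered abelian group $\Gamma$, if and only if its hybrid ball space is spherically complete. Here $\mathbb R((t^\Gamma))$ is the field of formal series $\sum_{\gamma\in\Gamma}c_\gamma t^\gamma$ with $c_\gamma\in\mathbb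 R$ and well-ordered support, ordered so that a nonzero series is positive if and only if the coefficient at the least element of its support is positive. -/

import Mathlib

universe u

/-- A ball space: a set `X` with a nonempty set of distinguished nonempty subsets, the balls. -/
structure BallSpace (X : Type u) where
  balls : Set (Set X)
  balls_nonempty : balls.Nonempty
  nonempty_of_mem : ∀ B ∈ balls, B.Nonempty

/-- A nest of balls: a nonempty collection of balls that is totally ordered by inclusion. -/
def BallSpace.IsNest {X : Type u} (S : BallSpace X) (N : Set (Set X)) : Prop :=
  N.Nonempty ∧ N ⊆ S.balls ∧ IsChain (· ⊆ ·) N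

/-- A ball space is spherically complete if every nest of balls has a nonempty intersection. -/
def BallSpace.SphericallyComplete {X : Type u} (S : BallSpace X) : Prop :=
  ∀ N : Set (Set X), S.IsNest N → (⋂₀ N).Nonempty

section OrderedField

variable (K : Type u) [Field K] [LinearOrder K] [IsStrictOrderedRing K]

/-- The natural valuation of an ordered field sends `a` to its archimedean class.
Mathlib writes it additively, `ArchimedeanClass.mk`: the smaller `|a|` is, the larger its class,
with `0` in the top class. So the ultrametric ball `{z | d (x, z) ≤ d (x, y)}` of the ultrametric
`d (x, y) = v (x - y)` is the following set. -/
def ultrametricBall {K : Type u} [Field K] [LinearOrder K] [IsStrictOrderedRing K]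
    (x y : K) : Set K :=
  {z | ArchimedeanClass.mk (x - y) ≤ ArchimedeanClass.mk (x - z)}

/-- In elementary terms: `z` lies in the ultrametric ball `B (x, y)` iff `|x - z|` is bounded by a
natural multiple of `|x - y|`. -/
theorem mem_ultrametricBall_iff {K : Type u} [Field K] [LinearOrder K] [IsStrictOrderedRing K]
    (x y z : K) : z ∈ ultrametricBall x y ↔ ∃ n : ℕ, |x - z| ≤ n • |x - y| :=
  ArchimedeanClass.mk_le_mk

/-- The order ball with center `g` and radius `r`. -/
def orderBall {K : Type u} [Field K] [LinearOrder K] [IsStrictOrderedRing K]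
    (g r : K) : Set K :=
  {z | |g - z| ≤ r}

/-- The set of all ultrametric balls of the natural valuation. -/
def ultrametricBalls : Set (Set K) :=
  {B | ∃ x y : K, B = ultrametricBall x y}

/-- The set of all order balls with rational center and positive rational radius. -/
def rationalOrderBalls : Set (Set K) :=
  {B | ∃ q r : ℚ, 0 < r ∧ B = orderBall (q : K) (r : K)}

/-- The hybrid ball space of an ordered field. -/
def hybridBallSpace : BallSpace K where
  balls := ultrametricBalls K ∪ rationalOrderBalls K
  balls_nonempty := ⟨ultrametricBall 0 0, Or.inl ⟨0, 0, rfl⟩⟩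
  nonempty_of_mem := by
    rintro B (⟨x, y, rfl⟩ | ⟨q, r, hr, rfl⟩)
    · exact ⟨y, le_refl (ArchimedeanClass.mk (x - y))⟩
    · refine ⟨(q : K), ?_⟩
      have h : (0 : K) ≤ (r : K) := by exact_mod_cast hr.le
      simpa [orderBall] using h

/-- `K` is isomorphic, as an ordered field, to a power series field `ℝ((t^Γ))` with exponents in
some totally ordered abelian group `Γ`. Here `HahnSeries Γ ℝ` is the field of formal sums with
well-ordered support, and `Lex` equips it with its standard ordering, in which a nonzero series is
positive iff its leading coefficient is positive. Its natural valuation is the order of vanishing,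
with residue field `ℝ`. As `Γ` embeds in `K`, taking it in the universe of `K` is no loss. -/
def IsoRealPowerSeriesField : Prop :=
  ∃ (Γ : Type u) (_ : AddCommGroup Γ) (_ : LinearOrder Γ) (_ : IsOrderedAddMonoid Γ),
    Nonempty (K ≃+*o Lex (HahnSeries Γ ℝ))

end OrderedField

/-! If the hybrid ball space is spherically complete, its ultrametric balls make the natural
valuation ball complete, and nests of rational intervals make the residue field all of ℝ. In a ball
complete field a strict contraction of a ball has a fixed point, which gives Newton's method and
Hensel's lemma. Hensel lifts ℝ into `K` and makes the group of positive units divisible; that group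
therefore splits off the positive elements, and a complement serves as a group of monomials t^γ. The
group algebra ℝ[Γ] maps into both `K` and ℝ((t^Γ)) with equal values, and both fields are ball
complete and immediate over its image. Kaplansky's uniqueness of such extensions
(`Valuation.exists_ringEquiv_of_immediate`) gives an isomorphism, which preserves the order because
an element has the sign of its leading monomial.

Conversely, nested ultrametric balls in ℝ((t^Γ)) have a common point built coefficient by
coefficient, and nested rational intervals meet in a real number. In a mixed nest, an ultrametric
ball of infinitesimal radius lies inside every order ball, and one of larger radius contains every
order ball. -/

open Polynomial Filter

/-! ### Ball completeness, contractions and Newton's method -/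

section BallComplete

variable {E Γ₀ : Type*} [Field E] [LinearOrderedCommGroupWithZero Γ₀]

/-- A valuation is ball complete if every family of pairwise intersecting closed balls has a
common point. -/
def Valuation.BallComplete (v : Valuation E Γ₀) : Prop :=
  ∀ S : Set (E × Γ₀), (∀ p ∈ S, ∀ q ∈ S, v (p.1 - q.1) ≤ max p.2 q.2) →
    ∃ z, ∀ p ∈ S, v (z - p.1) ≤ p.2

/-- The balls around `x` of radius `v (x - f x)` meet pairwise, by the ultrametric inequality. A
common point `z` moved by `f` would give `v (z - f z) ≤ v (f z - f (f z))`, against contraction. -/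
theorem Valuation.BallComplete.exists_fixedPoint {v : Valuation E Γ₀} (hv : v.BallComplete)
    (a : E) (δ : Γ₀) (f : E → E) (hf : ∀ x, v (x - a) ≤ δ → v (f x - a) ≤ δ)
    (hc : ∀ x y, v (x - a) ≤ δ → v (y - a) ≤ δ → x ≠ y → v (f x - f y) < v (x - y)) :
    ∃ z, v (z - a) ≤ δ ∧ f z = z := by
  obtain ⟨z, hz⟩ := hv {p | v (p.1 - a) ≤ δ ∧ p.2 = v (p.1 - f p.1)} (by
    rintro ⟨x, r⟩ ⟨hx, hr⟩ ⟨y, s⟩ ⟨hy, hs⟩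
    dsimp only at *
    subst hr hs
    rcases eq_or_ne x y with rfl | hxy
    · simp
    have h1 := hc x y hx hy hxy
    by_contra! h
    obtain ⟨h2, h3⟩ := max_lt_iff.1 h
    have : v ((x - f x) + (f x - f y) - (y - f y)) < v (x - y) :=
      v.map_sub_lt (v.map_add_lt h2 h1) h3
    ring_nf at this
    exact this.false)
  have hz' : ∀ y, v (y - a) ≤ δ → v (z - y) ≤ v (y - f y) := fun y hy ↦ hz (y, _) ⟨hy, rfl⟩
  have ha : v (a - a) ≤ δ := by simp
  have hza : v (z - a) ≤ δ := (hz' a ha).trans (by rw [v.map_sub_swap]; exact hf a ha)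
  refine ⟨z, hza, ?_⟩
  by_contra hne
  have h1 := hz' (f z) (hf z hza)
  have h2 := hc (f z) z (hf z hza) hza hne
  rw [v.map_sub_swap (f z) z] at h2
  rw [v.map_sub_swap (f z) (f (f z))] at h1
  exact (h1.trans_lt h2).false

theorem Valuation.map_pow_sub_pow_le (v : Valuation E Γ₀) {x y : E} {δ : Γ₀} (hx : v x ≤ δ)
    (hy : v y ≤ δ) (n : ℕ) : v (x ^ (n + 1) - y ^ (n + 1)) ≤ v (x - y) * δ ^ n := by
  rw [← Commute.geom_sum₂_mul (Commute.all x y), map_mul, mul_comm]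
  gcongr
  refine v.map_sum_le fun i hi ↦ ?_
  rw [Finset.mem_range] at hi
  rw [map_mul, map_pow, map_pow]
  calc v x ^ i * v y ^ (n + 1 - 1 - i) ≤ δ ^ i * δ ^ (n + 1 - 1 - i) := by gcongr
    _ = δ ^ n := by rw [← pow_add]; congr 1; omega

/-- Newton's method in a ball complete field. -/
theorem Valuation.BallComplete.exists_root {v : Valuation E Γ₀} (hv : v.BallComplete)
    (p : E[X]) (a : E) (δ : Γ₀) (h1 : (taylor a p).coeff 1 ≠ 0)
    (h0 : v ((taylor a p).coeff 0) ≤ δ * v ((taylor a p).coeff 1))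
    (h : ∀ i, v ((taylor a p).coeff (i + 2)) * δ ^ (i + 1) < v ((taylor a p).coeff 1)) :
    ∃ b, p.eval b = 0 ∧ v (b - a) ≤ δ := by
  set q := taylor a p with hq
  have hp (x) : p.eval x = q.eval (x - a) := by rw [hq, taylor_eval, sub_add_cancel]
  have hc1 : 0 < v (q.coeff 1) := v.pos_iff.2 h1
  -- On the ball of radius `δ` the linear Taylor term dominates every difference `q x - q y`.
  have key (x y : E) (hx : v x ≤ δ) (hy : v y ≤ δ) (hxy : x ≠ y) :
      v (q.eval x - q.eval y - q.coeff 1 * (x - y)) < v (x - y) * v (q.coeff 1) := by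
    have hxy' : 0 < v (x - y) := v.pos_iff.2 (sub_ne_zero.2 hxy)
    have : q.eval x - q.eval y - q.coeff 1 * (x - y) =
        ∑ i ∈ Finset.range (q.natDegree + 1),
          (q.coeff i * (x ^ i - y ^ i) - if i = 1 then q.coeff 1 * (x - y) else 0) := by
      rw [Finset.sum_sub_distrib, eval_eq_sum_range, eval_eq_sum_range, ← Finset.sum_sub_distrib]
      simp_rw [mul_sub]
      congr 1
      rw [Finset.sum_ite_eq']
      split_ifs with hn
      · rfl
      · rw [coeff_eq_zero_of_natDegree_lt (by simpa using hn)]; simp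
    rw [this]
    refine v.map_sum_lt' (mul_pos hxy' hc1) fun i _ ↦ ?_
    match i with
    | 0 => simpa using mul_pos hxy' hc1
    | 1 => simpa using mul_pos hxy' hc1
    | i + 2 =>
      rw [if_neg (by omega), sub_zero, map_mul]
      calc v (q.coeff (i + 2)) * v (x ^ (i + 2) - y ^ (i + 2))
          ≤ v (q.coeff (i + 2)) * (v (x - y) * δ ^ (i + 1)) := by
            gcongr; exact v.map_pow_sub_pow_le hx hy _
        _ = v (x - y) * (v (q.coeff (i + 2)) * δ ^ (i + 1)) := mul_left_comm ..
        _ < _ := by gcongr; exact h i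
  -- The Newton map with slope frozen at `a` is a strict contraction; its fixed points are the roots
  -- of `p`.
  have contr (x y : E) (hx : v (x - a) ≤ δ) (hy : v (y - a) ≤ δ) (hxy : x ≠ y) :
      v (x - p.eval x / q.coeff 1 - (y - p.eval y / q.coeff 1)) < v (x - y) := by
    have := key (x - a) (y - a) hx hy (by simpa using hxy)
    rw [← hp, ← hp, sub_sub_sub_cancel_right, ← div_lt_iff₀ hc1, ← map_div₀] at this
    convert this using 1
    rw [← v.map_neg]
    congr 1
    field_simp
    ring
  have ha : v (a - p.eval a / q.coeff 1 - a) ≤ δ := by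
    rw [sub_sub_cancel_left, v.map_neg, map_div₀, div_le_iff₀ hc1, hp, sub_self,
      ← coeff_zero_eq_eval_zero]
    exact h0
  obtain ⟨z, hz, hz'⟩ := hv.exists_fixedPoint a δ (fun x ↦ x - p.eval x / q.coeff 1) (by
    intro x hx
    rcases eq_or_ne x a with rfl | hxa
    · exact ha
    have := contr x a hx (by simp) hxa
    have := v.map_add_le (this.le.trans hx) ha
    convert this using 2; ring) contr
  refine ⟨z, ?_, hz⟩
  have : p.eval z / q.coeff 1 = 0 := by simpa using hz'
  exact (div_eq_zero_iff.1 this).resolve_right h1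

end BallComplete

/-! ### Division with remainder over a ring -/

section PseudoDivision

/-- The Zorn arguments below extend subrings, so leading coefficients cannot be inverted; a power of
the leading coefficient is multiplied in and cancelled later in a field. -/
theorem Polynomial.exists_pseudo_division {R : Type*} [CommRing R] (p : R[X])
    (hp : p.natDegree ≠ 0) (q : R[X]) :
    ∃ (k : ℕ) (s r : R[X]), C (p.leadingCoeff ^ k) * q = s * p + r ∧
      r.natDegree < p.natDegree := by
  induction hn : q.natDegree using Nat.strong_induction_on generalizing q with
  | _ n ih =>
    subst hn
    by_cases hq : q.natDegree < p.natDegree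
    · exact ⟨0, 0, q, by simp, hq⟩
    set q₁ := C p.leadingCoeff * q - C q.leadingCoeff * (X ^ (q.natDegree - p.natDegree) * p)
      with hq₁
    have hlt : q₁.natDegree < q.natDegree := by
      suffices q₁.natDegree ≤ q.natDegree - 1 by omega
      refine natDegree_le_iff_coeff_eq_zero.2 fun N hN ↦ ?_
      rw [hq₁, coeff_sub, coeff_C_mul, coeff_C_mul, coeff_X_pow_mul', if_pos (by omega)]
      rcases (show q.natDegree ≤ N by omega).eq_or_lt with rfl | h
      · rw [Nat.sub_sub_self (not_lt.1 hq)]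
        simp [mul_comm]
      · rw [coeff_eq_zero_of_natDegree_lt h, coeff_eq_zero_of_natDegree_lt (by omega)]
        simp
    obtain ⟨k, s, r, h, hr⟩ := ih _ hlt q₁ rfl
    refine ⟨k + 1, s + C (p.leadingCoeff ^ k * q.leadingCoeff) *
      X ^ (q.natDegree - p.natDegree), r, ?_, hr⟩
    have : C (p.leadingCoeff ^ (k + 1)) * q = C (p.leadingCoeff ^ k) * q₁ +
        C (p.leadingCoeff ^ k) * (C q.leadingCoeff * (X ^ (q.natDegree - p.natDegree) * p)) := by
      rw [hq₁, pow_succ, C_mul]; ring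
    rw [this, h, C_mul]
    ring

end PseudoDivision

/-! ### Values of polynomials along a pseudo-convergent family -/

section Dominance

variable {ι E Γ₀ : Type*} [Field E] [LinearOrderedCommGroupWithZero Γ₀]
  {T : Filter ι} {d : ι → Γ₀}

/-- A quantity that keeps strictly decreasing meets a given level at most once; the exponent `n + 1`
keeps the power strictly monotone. -/
theorem eventually_pow_lt_or_lt_pow (hT : ∀ i, ∀ᶠ j in T, d j < d i) (n : ℕ) (c : Γ₀) :
    (∀ᶠ i in T, d i ^ (n + 1) < c) ∨ ∀ᶠ i in T, c < d i ^ (n + 1) := by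
  by_cases h : ∃ i, d i ^ (n + 1) ≤ c
  · obtain ⟨i, hi⟩ := h
    left
    filter_upwards [hT i] with j hj
    exact (pow_lt_pow_left₀ hj zero_le (by simp)).trans_le hi
  · push Not at h
    exact .inr (.of_forall h)

theorem eventually_mul_pow_lt_or_of_lt (hd : ∀ i, d i ≠ 0) (hT : ∀ i, ∀ᶠ j in T, d j < d i)
    {b c : Γ₀} (hc : c ≠ 0) {i j : ℕ} (hij : i < j) :
    (∀ᶠ l in T, b * d l ^ i < c * d l ^ j) ∨ ∀ᶠ l in T, c * d l ^ j < b * d l ^ i := by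
  obtain ⟨n, rfl⟩ : ∃ n, j = i + (n + 1) := ⟨j - i - 1, by omega⟩
  have hc' : 0 < c := zero_lt_iff.2 hc
  have hd' (l) : 0 < d l ^ i := zero_lt_iff.2 (pow_ne_zero _ (hd l))
  rcases eventually_pow_lt_or_lt_pow hT n (b / c) with h | h
  · right
    filter_upwards [h] with l hl
    rw [lt_div_iff₀ hc'] at hl
    calc c * d l ^ (i + (n + 1)) = d l ^ (n + 1) * c * d l ^ i := by rw [pow_add _ i (n + 1)]; ac_rfl
      _ < _ := by gcongr; exact hd' l
  · left
    filter_upwards [h] with l hl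
    rw [div_lt_iff₀ hc'] at hl
    calc b * d l ^ i < d l ^ (n + 1) * c * d l ^ i := by gcongr; exact hd' l
      _ = _ := by rw [pow_add _ i (n + 1)]; ac_rfl

theorem eventually_mul_pow_lt_or (hd : ∀ i, d i ≠ 0) (hT : ∀ i, ∀ᶠ j in T, d j < d i)
    {b c : Γ₀} (hb : b ≠ 0) (hc : c ≠ 0) {i j : ℕ} (hij : i ≠ j) :
    (∀ᶠ l in T, b * d l ^ i < c * d l ^ j) ∨ ∀ᶠ l in T, c * d l ^ j < b * d l ^ i := by
  rcases hij.lt_or_gt with h | h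
  · exact eventually_mul_pow_lt_or_of_lt hd hT hc h
  · exact (eventually_mul_pow_lt_or_of_lt hd hT hb h).symm

theorem exists_eventually_dominant (hd : ∀ i, d i ≠ 0) (hT : ∀ i, ∀ᶠ j in T, d j < d i)
    (β : ℕ → Γ₀) {s : Finset ℕ} (hs : s.Nonempty) (hβ : ∀ i ∈ s, β i ≠ 0) :
    ∃ k ∈ s, ∀ j ∈ s, j ≠ k → ∀ᶠ l in T, β j * d l ^ j < β k * d l ^ k := by
  induction hs using Finset.Nonempty.cons_induction with
  | singleton a => exact ⟨a, by simp, by simp⟩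
  | cons a s ha hs ih =>
    obtain ⟨k, hk, h⟩ := ih fun i hi ↦ hβ i (by simp [hi])
    have hak : a ≠ k := by rintro rfl; exact ha hk
    rcases eventually_mul_pow_lt_or hd hT (hβ a (by simp)) (hβ k (by simp [hk])) hak with h' | h'
    · refine ⟨k, by simp [hk], fun j hj hjk ↦ ?_⟩
      rcases Finset.mem_cons.1 hj with rfl | hj
      · exact h'
      · exact h j hj hjk
    · refine ⟨a, by simp, fun j hj hja ↦ ?_⟩
      have hj := (Finset.mem_cons.1 hj).resolve_left hja
      by_cases hjk : j = k
      · rwa [hjk]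
      · filter_upwards [h j hj hjk, h'] with l h1 h2 using h1.trans h2

theorem Polynomial.exists_dominant_coeff_taylor {v : Valuation E Γ₀} {a : E} {s : ι → E}
    (hd : ∀ i, v (a - s i) ≠ 0) (hT : ∀ i, ∀ᶠ j in T, v (a - s j) < v (a - s i))
    {P : E[X]} (hP : P ≠ 0) :
    ∃ k, (taylor a P).coeff k ≠ 0 ∧
      (∀ j ≠ k, ∀ᶠ l in T, v ((taylor a P).coeff j) * v (a - s l) ^ j <
        v ((taylor a P).coeff k) * v (a - s l) ^ k) ∧
      ∀ᶠ l in T, v (P.eval (s l)) = v ((taylor a P).coeff k) * v (a - s l) ^ k := by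
  set q := taylor a P with hq
  have hq0 : q ≠ 0 := by rwa [hq, Ne, taylor_eq_zero]
  obtain ⟨k, hk, h⟩ := exists_eventually_dominant hd hT (fun i ↦ v (q.coeff i))
    (s := q.support) (by rwa [support_nonempty]) (fun i hi ↦ v.ne_zero_iff.2 (mem_support_iff.1 hi))
  have hk0 : q.coeff k ≠ 0 := mem_support_iff.1 hk
  refine ⟨k, hk0, fun j hj ↦ ?_, ?_⟩
  · by_cases hj' : j ∈ q.support
    · exact h j hj' hj
    · rw [notMem_support_iff.1 hj', map_zero]
      refine .of_forall fun l ↦ ?_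
      rw [zero_mul]
      exact zero_lt_iff.2 (mul_ne_zero (v.ne_zero_iff.2 hk0) (pow_ne_zero _ (hd l)))
  · have : ∀ᶠ l in T, ∀ j ∈ q.support, j ≠ k →
        v (q.coeff j) * v (a - s l) ^ j < v (q.coeff k) * v (a - s l) ^ k := by
      rw [Filter.eventually_all_finset]
      intro j hj
      by_cases hjk : j = k
      · exact .of_forall fun l hl ↦ absurd hjk hl
      · filter_upwards [h j hj hjk] with l hl _ using hl
    filter_upwards [this] with l hl
    have e : P.eval (s l) = ∑ i ∈ q.support, q.coeff i * (s l - a) ^ i := by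
      rw [← sub_add_cancel (s l) a, ← taylor_eval, add_sub_cancel_right, eval_eq_sum, sum_def]
    have hv (i) : v (q.coeff i * (s l - a) ^ i) = v (q.coeff i) * v (a - s l) ^ i := by
      rw [map_mul, map_pow, v.map_sub_swap]
    rw [e, ← hv, v.map_sum_eq_of_lt hk]
    intro i hi
    rw [Finset.mem_sdiff, Finset.mem_singleton] at hi
    rw [hv, hv]
    exact hl i hi.1 hi.2

/-- If the dominant Taylor term had positive degree, the value of `P` would keep strictly decreasing
with the distance, so stability forces the constant term to dominate. -/
theorem Polynomial.eventually_eval_of_stable [T.NeBot] {v : Valuation E Γ₀} {a : E} {s : ι → E}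
    (hd : ∀ i, v (a - s i) ≠ 0) (hT : ∀ i, ∀ᶠ j in T, v (a - s j) < v (a - s i))
    {P : E[X]} (hP : P ≠ 0) (hst : ∃ γ, ∀ᶠ l in T, v (P.eval (s l)) = γ) :
    (taylor a P).coeff 0 ≠ 0 ∧ (∀ j, ∀ᶠ l in T,
      v ((taylor a P).coeff (j + 1)) * v (a - s l) ^ (j + 1) < v ((taylor a P).coeff 0)) ∧
      ∀ᶠ l in T, v (P.eval (s l)) = v (P.eval a) := by
  obtain ⟨k, hk, h1, h2⟩ := exists_dominant_coeff_taylor hd hT hP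
  obtain rfl : k = 0 := by
    by_contra hk0
    obtain ⟨γ, hγ⟩ := hst
    obtain ⟨l, hl1, hl2⟩ := (hγ.and h2).exists
    obtain ⟨m, ⟨hm1, hm2⟩, hm3⟩ := ((hγ.and h2).and (hT l)).exists
    have : v (a - s m) ^ k < v (a - s l) ^ k := pow_lt_pow_left₀ hm3 zero_le hk0
    have := mul_lt_mul_of_pos_left this (v.pos_iff.2 hk)
    rw [← hl2, ← hm2, hl1, hm1] at this
    exact this.false
  refine ⟨hk, fun j ↦ ?_, ?_⟩
  · simpa using h1 (j + 1) (by simp)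
  · simpa using h2

theorem Polynomial.taylor_derivative (a : E) (P : E[X]) :
    taylor a (derivative P) = derivative (taylor a P) := by
  simp [taylor_apply, derivative_comp]

/-- If the values of `P` do not stabilise along `s` while those of its derivative do, then `P` has a
root with the same distances as `a` to the points of `s`. -/
theorem Polynomial.exists_root_of_not_stable [T.NeBot] [CharZero E] {v : Valuation E Γ₀}
    (hv : v.BallComplete) (hnat : ∀ n : ℕ, v ((n : E) + 1) = 1) {a : E} {s : ι → E}
    (hd : ∀ i, v (a - s i) ≠ 0) (hT : ∀ i, ∀ᶠ j in T, v (a - s j) < v (a - s i))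
    {P : E[X]} (hP : ¬ ∃ γ, ∀ᶠ l in T, v (P.eval (s l)) = γ)
    (hst : ∃ γ, ∀ᶠ l in T, v ((derivative P).eval (s l)) = γ) :
    ∃ b, P.eval b = 0 ∧ ∀ l, v (b - s l) = v (a - s l) := by
  have hD : derivative P ≠ 0 := by
    intro h
    rw [eq_C_of_derivative_eq_zero h] at hP
    exact hP ⟨_, .of_forall fun l ↦ by rw [eval_C]⟩
  have hP0 : P ≠ 0 := by rintro rfl; exact hD derivative_zero
  obtain ⟨h1, h2, -⟩ := eventually_eval_of_stable hd hT hD hst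
  obtain ⟨k, hk, h3, h4⟩ := exists_dominant_coeff_taylor hd hT hP0
  set q := taylor a P with hq
  have hcoeff (j) : v ((taylor a (derivative P)).coeff j) = v (q.coeff (j + 1)) := by
    rw [taylor_derivative, coeff_derivative, map_mul, hnat, mul_one]
  have hq1 : v (q.coeff 1) ≠ 0 := by rw [← zero_add 1, ← hcoeff]; exact v.ne_zero_iff.2 h1
  simp_rw [hcoeff] at h2
  -- Degree 0 would make `P` stable. Positive integers are units, so stability of the derivative
  -- makes the linear term of `P` beat all higher ones.
  obtain rfl : k = 1 := by
    match k with
    | 0 => exact absurd ⟨_, by simpa using h4⟩ hP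
    | 1 => rfl
    | j + 2 =>
      obtain ⟨l, hl1, hl2⟩ := ((h3 1 (by simp)).and (h2 j)).exists
      rw [pow_one, pow_succ, ← mul_assoc] at hl1
      exact absurd (lt_of_mul_lt_mul_right hl1 zero_le) hl2.le.not_gt
  have hq1' : 0 < v (q.coeff 1) := zero_lt_iff.2 hq1
  -- The size of the first Newton correction. It lies below every distance from `a` to the family,
  -- so the root found is as far from each `s l` as `a` is.
  set δ := v (q.coeff 0) / v (q.coeff 1) with hδ
  have hδ' : ∀ᶠ l in T, δ < v (a - s l) := by
    filter_upwards [h3 0 (by simp)] with l hl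
    rw [hδ, div_lt_iff₀ hq1']
    simpa [mul_comm] using hl
  have hδ'' (i) : δ < v (a - s i) := by
    obtain ⟨l, h, h'⟩ := (hδ'.and (hT i)).exists
    exact h.trans h'
  obtain ⟨b, hb, hba⟩ := hv.exists_root P a δ (v.ne_zero_iff.1 hq1)
    (by rw [← hq, hδ, div_mul_cancel₀ _ hq1]) (fun i ↦ by
      obtain ⟨l, hl⟩ := (h2 i).exists
      refine lt_of_le_of_lt ?_ hl
      rw [← hq]
      gcongr
      exact (hδ'' l).le)
  refine ⟨b, hb, fun l ↦ ?_⟩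
  rw [← sub_add_sub_cancel b a (s l)]
  exact v.map_add_eq_of_lt_right (hba.trans_lt (hδ'' l))

end Dominance

/-! ### Kaplansky's extension step -/

section Transfer

variable {L E E' Γ₀ : Type*} [CommRing L] [Field E] [Field E'] [CharZero E] [CharZero E']
  [LinearOrderedCommGroupWithZero Γ₀]

/-- If every polynomial over `L` has eventually constant value, that value is computed in `L` and
shared by all limits, so `a` and `a'` serve. Otherwise an unstable polynomial of least degree has a
stable derivative, hence a root among the limits in each field; reducing modulo it leaves only
stable remainders. -/
theorem Valuation.exists_transfer {v : Valuation E Γ₀} {v' : Valuation E' Γ₀}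
    (hv : v.BallComplete) (hv' : v'.BallComplete)
    (hn : ∀ n : ℕ, v ((n : E) + 1) = 1) (hn' : ∀ n : ℕ, v' ((n : E') + 1) = 1)
    (φ : L →+* E) (φ' : L →+* E') (hφ : Function.Injective φ) (h : ∀ x, v (φ x) = v' (φ' x))
    {a : E} {a' : E'} (ha : ∀ l, v (a - φ l) ≠ 0) (haa' : ∀ l, v' (a' - φ' l) = v (a - φ l))
    (hmin : ∀ l, ∃ m, v (a - φ m) < v (a - φ l)) :
    ∃ (b : E) (b' : E'), (∀ l, v (b - φ l) = v (a - φ l)) ∧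
      ∀ p : L[X], v (p.eval₂ φ b) = v' (p.eval₂ φ' b') := by
  set d : L → Γ₀ := fun l ↦ v (a - φ l) with hd
  -- This filter of ever better approximations to `a` replaces a pseudo-Cauchy sequence; it is
  -- proper because no approximation is best.
  let T : Filter L := ⨅ i, 𝓟 {j | d j < d i}
  have hT (i) : ∀ᶠ j in T, d j < d i := mem_iInf_of_mem i (mem_principal_self _)
  have : T.NeBot := by
    refine iInf_neBot_of_directed' (fun i j ↦ ?_) fun i ↦ principal_neBot_iff.2 (hmin i)
    rcases le_total (d i) (d j) with hij | hij
    · exact ⟨i, le_rfl, principal_mono.2 fun l hl ↦ lt_of_lt_of_le hl hij⟩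
    · exact ⟨j, principal_mono.2 fun l hl ↦ lt_of_lt_of_le hl hij, le_rfl⟩
  have hev (p : L[X]) (l) : v ((p.map φ).eval (φ l)) = v (φ (p.eval l)) := by
    rw [eval_map_apply]
  have hev' (p : L[X]) (l) : v' ((p.map φ').eval (φ' l)) = v (φ (p.eval l)) := by
    rw [eval_map_apply, h]
  have agree (p : L[X]) (hp : ∃ γ, ∀ᶠ l in T, v (φ (p.eval l)) = γ) (b : E) (b' : E')
      (hb : ∀ l, v (b - φ l) = d l) (hb' : ∀ l, v' (b' - φ' l) = d l) :
      v (p.eval₂ φ b) = v' (p.eval₂ φ' b') := by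
    rcases eq_or_ne p 0 with rfl | hp0
    · simp
    have hφ' : Function.Injective φ' := by
      rw [injective_iff_map_eq_zero] at hφ ⊢
      intro x hx
      exact hφ x (by rw [← v.zero_iff, h, hx, map_zero])
    have e := (eventually_eval_of_stable (T := T) (v := v) (a := b) (s := φ) (P := p.map φ)
      (by simpa only [hb]) (by simpa only [hb]) ((Polynomial.map_ne_zero_iff hφ).2 hp0)
      (by simpa only [hev])).2.2
    have e' := (eventually_eval_of_stable (T := T) (v := v') (a := b') (s := φ') (P := p.map φ')
      (by simpa only [hb']) (by simpa only [hb']) ((Polynomial.map_ne_zero_iff hφ').2 hp0)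
      (by simpa only [hev'])).2.2
    obtain ⟨l, h1, h2⟩ := (e.and e').exists
    rw [← eval_map, ← eval_map, ← h1, ← h2, hev, hev']
  by_cases hall : ∀ p : L[X], ∃ γ, ∀ᶠ l in T, v (φ (p.eval l)) = γ
  · exact ⟨a, a', fun _ ↦ rfl, fun p ↦ agree p (hall p) a a' (fun _ ↦ rfl) haa'⟩
  push Not at hall
  let N : Set ℕ := {n | ∃ p : L[X], p.natDegree = n ∧ ¬ ∃ γ, ∀ᶠ l in T, v (φ (p.eval l)) = γ}
  have hN : N.Nonempty := by
    obtain ⟨p, hp⟩ := hall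
    exact ⟨_, p, rfl, by push Not; exact hp⟩
  obtain ⟨p, hpn, hp⟩ := WellFounded.min_mem wellFounded_lt N hN
  have hlow (q : L[X]) (hq : q.natDegree < p.natDegree) :
      ∃ γ, ∀ᶠ l in T, v (φ (q.eval l)) = γ := by
    by_contra hc
    exact WellFounded.not_lt_min wellFounded_lt N ⟨q, rfl, hc⟩ (hpn ▸ hq)
  have hp0 : p.natDegree ≠ 0 := by
    intro h0
    rw [eq_C_of_natDegree_eq_zero h0] at hp
    exact hp ⟨_, .of_forall fun l ↦ by rw [eval_C]⟩
  have hder := hlow _ (natDegree_derivative_lt hp0)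
  obtain ⟨b, hb, hbl⟩ := exists_root_of_not_stable (T := T) hv hn (a := a) (s := φ) (P := p.map φ)
    ha hT (by simpa only [hev]) (by simpa only [derivative_map, hev])
  obtain ⟨b', hb', hbl'⟩ := exists_root_of_not_stable (T := T) hv' hn' (a := a') (s := φ')
    (P := p.map φ') (by simpa only [haa']) (by simpa only [haa']) (by simpa only [hev'])
    (by simpa only [derivative_map, hev'])
  refine ⟨b, b', hbl, fun q ↦ ?_⟩
  obtain ⟨k, s, r, hqr, hr⟩ := exists_pseudo_division p hp0 q
  have hr' := agree r (hlow r hr) b b' hbl (fun l ↦ (hbl' l).trans (haa' l))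
  have e1 := congr(eval₂ φ b $hqr)
  have e2 := congr(eval₂ φ' b' $hqr)
  rw [eval_map] at hb hb'
  simp only [eval₂_mul, eval₂_add, eval₂_C, hb, hb', mul_zero, zero_add] at e1 e2
  rw [← e1, ← e2, map_mul, map_mul, h] at hr'
  refine mul_left_cancel₀ ?_ hr'
  rw [← h, v.ne_zero_iff, map_pow]
  refine pow_ne_zero _ ((_root_.map_ne_zero_iff _ hφ).2 (leadingCoeff_ne_zero.2 ?_))
  rintro rfl
  exact hp0 natDegree_zero

end Transfer

/-! ### Uniqueness of ball complete immediate extensions -/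

section Maximal

/-- Zorn's lemma; the last clause holds because the polynomial values at `b` form the ring `G[b]`.
In a product of two rings, `G` plays the graph of a partial isomorphism. -/
theorem Subring.exists_maximal_of_forall {R : Type*} [CommRing R] (P : R → Prop) (G₀ : Subring R)
    (h₀ : ∀ x ∈ G₀, P x) :
    ∃ G : Subring R, G₀ ≤ G ∧ (∀ x ∈ G, P x) ∧
      ∀ b, (∀ q : G[X], P (q.eval₂ G.subtype b)) → b ∈ G := by
  obtain ⟨G, hG₀, hG⟩ := zorn_le_nonempty₀ {G : Subring R | ∀ x ∈ G, P x} (fun c hc hch y hy ↦ by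
    refine ⟨sSup c, fun x hx ↦ ?_, fun z hz ↦ le_sSup hz⟩
    obtain ⟨s, hs, hxs⟩ := (Subring.mem_sSup_of_directedOn ⟨y, hy⟩ hch.directedOn).1 hx
    exact hc hs x hxs) G₀ h₀
  refine ⟨G, hG₀, hG.prop, fun b hb ↦ ?_⟩
  refine hG.le_of_ge (y := (eval₂RingHom G.subtype b).range) ?_ ?_ ?_
  · rintro _ ⟨q, rfl⟩
    exact hb q
  · intro x hx
    exact ⟨C ⟨x, hx⟩, by simp⟩
  · exact ⟨X, by simp⟩

variable {L E E' Γ₀ : Type*} [CommRing L] [Field E] [Field E'] [CharZero E] [CharZero E']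
  [LinearOrderedCommGroupWithZero Γ₀]

/-- An element `a` outside the image has no best approximation, by immediacy. The same family has a
limit in `E'`, and transfer yields a pair that maximality puts in the image, although its distances
to the image never vanish. -/
theorem Valuation.surjective_of_maximal {v : Valuation E Γ₀} {v' : Valuation E' Γ₀}
    (hv : v.BallComplete) (hv' : v'.BallComplete)
    (hn : ∀ n : ℕ, v ((n : E) + 1) = 1) (hn' : ∀ n : ℕ, v' ((n : E') + 1) = 1)
    (φ : L →+* E) (φ' : L →+* E') (hφ : Function.Injective φ) (h : ∀ x, v (φ x) = v' (φ' x))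
    (himm : ∀ a ≠ 0, ∃ x, v (a - φ x) < v a)
    (hmax : ∀ b b', (∀ p : L[X], v (p.eval₂ φ b) = v' (p.eval₂ φ' b')) → b ∈ Set.range φ) :
    Function.Surjective φ := by
  intro a
  by_contra hna
  have hne (l) : a - φ l ≠ 0 := fun h0 ↦ hna ⟨l, (sub_eq_zero.1 h0).symm⟩
  have hmin (l) : ∃ m, v (a - φ m) < v (a - φ l) := by
    obtain ⟨x, hx⟩ := himm _ (hne l)
    exact ⟨l + x, by rwa [map_add, ← sub_sub]⟩
  have hd (l m) : v' (φ' l - φ' m) = v ((a - φ m) - (a - φ l)) := by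
    rw [← _root_.map_sub φ', ← h, _root_.map_sub φ, sub_sub_sub_cancel_left]
  obtain ⟨a', ha'⟩ := hv' (Set.range fun l ↦ (φ' l, v (a - φ l))) (by
    rintro _ ⟨l, rfl⟩ _ ⟨m, rfl⟩
    dsimp only
    rw [hd, max_comm]
    exact v.map_sub _ _)
  -- The limit only bounds the distance from above; comparison with a closer `m` makes it exact.
  have haa' (l) : v' (a' - φ' l) = v (a - φ l) := by
    obtain ⟨m, hm⟩ := hmin l
    have h1 : v' (a' - φ' m) ≤ v (a - φ m) := ha' _ ⟨m, rfl⟩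
    have h2 : v' (φ' m - φ' l) = v (a - φ l) := by
      rw [hd, v.map_sub_eq_of_lt_left hm]
    rw [← h2, ← sub_add_sub_cancel a' (φ' m) (φ' l)]
    exact v'.map_add_eq_of_lt_right (h2 ▸ h1.trans_lt hm)
  obtain ⟨b, b', hb, hbb'⟩ := exists_transfer hv hv' hn hn' φ φ' hφ h
    (fun l ↦ v.ne_zero_iff.2 (hne l)) haa' hmin
  obtain ⟨l, hl⟩ := hmax b b' hbb'
  refine v.ne_zero_iff.2 (hne l) ?_
  rw [← hb l, hl, sub_self, map_zero]

/-- Uniqueness of ball complete immediate extensions in residue characteristic zero. -/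
theorem Valuation.exists_ringEquiv_of_immediate {v : Valuation E Γ₀} {v' : Valuation E' Γ₀}
    (hv : v.BallComplete) (hv' : v'.BallComplete)
    (hn : ∀ n : ℕ, v ((n : E) + 1) = 1) (hn' : ∀ n : ℕ, v' ((n : E') + 1) = 1)
    (G₀ : Subring (E × E')) (h₀ : ∀ x ∈ G₀, v x.1 = v' x.2)
    (himm : ∀ a ≠ 0, ∃ x ∈ G₀, v (a - x.1) < v a)
    (himm' : ∀ a ≠ 0, ∃ x ∈ G₀, v' (a - x.2) < v' a) :
    ∃ e : E ≃+* E', (∀ x, v' (e x) = v x) ∧ ∀ x ∈ G₀, e x.1 = x.2 := by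
  obtain ⟨G, hG₀, hG, hmax⟩ := Subring.exists_maximal_of_forall (fun x ↦ v x.1 = v' x.2) G₀ h₀
  let φ : G →+* E := (RingHom.fst E E').comp G.subtype
  let φ' : G →+* E' := (RingHom.snd E E').comp G.subtype
  have h (x : G) : v (φ x) = v' (φ' x) := hG x x.2
  -- Equal values force both coordinates to vanish together, so `G` is the graph of an injective
  -- map.
  have hzero (x : G) : φ x = 0 ↔ φ' x = 0 := by
    rw [← v.zero_iff, h, v'.zero_iff]
  have hφ : Function.Injective φ := by
    rw [injective_iff_map_eq_zero]
    exact fun x hx ↦ Subtype.ext (Prod.ext hx ((hzero x).1 hx))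
  have hφ' : Function.Injective φ' := by
    rw [injective_iff_map_eq_zero]
    exact fun x hx ↦ Subtype.ext (Prod.ext ((hzero x).2 hx) hx)
  have hmem (b b') (hb : ∀ p : G[X], v (p.eval₂ φ b) = v' (p.eval₂ φ' b')) : (b, b') ∈ G := by
    refine hmax _ fun q ↦ ?_
    convert hb q
    · exact hom_eval₂ q G.subtype (RingHom.fst E E') (b, b')
    · exact hom_eval₂ q G.subtype (RingHom.snd E E') (b, b')
  have hs : Function.Surjective φ := surjective_of_maximal hv hv' hn hn' φ φ' hφ h
    (fun a ha ↦ by obtain ⟨x, hx, hx'⟩ := himm a ha; exact ⟨⟨x, hG₀ hx⟩, hx'⟩)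
    (fun b b' hb ↦ ⟨⟨_, hmem b b' hb⟩, rfl⟩)
  have hs' : Function.Surjective φ' := surjective_of_maximal hv' hv hn' hn φ' φ hφ'
    (fun x ↦ (h x).symm)
    (fun a ha ↦ by obtain ⟨x, hx, hx'⟩ := himm' a ha; exact ⟨⟨x, hG₀ hx⟩, hx'⟩)
    (fun b b' hb ↦ ⟨⟨_, hmem b' b fun p ↦ (hb p).symm⟩, rfl⟩)
  let e₁ := RingEquiv.ofBijective φ ⟨hφ, hs⟩
  let e₂ := RingEquiv.ofBijective φ' ⟨hφ', hs'⟩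
  have he (x : G) : e₁.symm.trans e₂ (φ x) = φ' x := by
    rw [RingEquiv.trans_apply, show φ x = e₁ x from rfl, e₁.symm_apply_apply]
    rfl
  refine ⟨e₁.symm.trans e₂, fun x ↦ ?_, fun x hx ↦ he ⟨x, hG₀ hx⟩⟩
  obtain ⟨l, rfl⟩ := hs x
  rw [he, h]

end Maximal

/-! ### Hensel's lemma -/

section Hensel

variable {E Γ₀ : Type*} [Field E] [LinearOrderedCommGroupWithZero Γ₀]

/-- Newton's method with radius `v (p.eval a)`; the Taylor coefficients at `a` stay in the valuation
ring. -/
theorem Valuation.BallComplete.hensel {v : Valuation E Γ₀} (hv : v.BallComplete) (p : E[X]) (a : E)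
    (hp : ∀ i, v (p.coeff i) ≤ 1) (ha : v a ≤ 1) (h0 : v (p.eval a) < 1)
    (h1 : v ((derivative p).eval a) = 1) : ∃ b, p.eval b = 0 ∧ v (b - a) < 1 := by
  have hcoeff (i) : v ((taylor a p).coeff i) ≤ 1 := by
    let q := p.toSubring v.integer (by
      intro c hc
      obtain ⟨n, -, rfl⟩ := mem_coeffs_iff.1 hc
      exact hp n)
    have hq : q.map v.integer.subtype = p := map_toSubring ..
    rw [← hq, show a = v.integer.subtype ⟨a, ha⟩ from rfl, ← map_taylor, coeff_map]
    exact ((taylor (⟨a, ha⟩ : v.integer) q).coeff i).2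
  obtain ⟨b, hb, hba⟩ := hv.exists_root p a (v (p.eval a))
    (by rw [taylor_coeff_one, ← v.ne_zero_iff, h1]; exact one_ne_zero)
    (by rw [taylor_coeff_one, h1, taylor_coeff_zero, mul_one])
    (fun i ↦ by
      rw [taylor_coeff_one, h1]
      calc v ((taylor a p).coeff (i + 2)) * v (p.eval a) ^ (i + 1)
          ≤ 1 * v (p.eval a) ^ (i + 1) := by gcongr; exact hcoeff _
        _ < 1 := by rw [one_mul]; exact pow_lt_one₀ zero_le h0 (by simp))
  exact ⟨b, hb, hba.trans_lt h0⟩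

end Hensel

/-! ### Natural valuation, residue field ℝ and its lifting -/

section OrderedFieldValuation

variable (K : Type u) [Field K] [LinearOrder K] [IsStrictOrderedRing K]

/-- The natural valuation of an ordered field, written multiplicatively. -/
noncomputable def archValuation : Valuation K (Multiplicative (ArchimedeanClass K)ᵒᵈ) :=
  (ArchimedeanClass.addValuation K).toValuation

variable {K}

theorem archValuation_le_iff {x y : K} :
    archValuation K x ≤ archValuation K y ↔ ArchimedeanClass.mk y ≤ ArchimedeanClass.mk x := .rfl

theorem archValuation_lt_one_iff {x : K} :
    archValuation K x < 1 ↔ 0 < ArchimedeanClass.mk x := .rfl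

theorem archValuation_eq_one_iff {x : K} :
    archValuation K x = 1 ↔ ArchimedeanClass.mk x = 0 := .rfl

theorem archValuation_surjective : Function.Surjective (archValuation K) :=
  fun c ↦ ArchimedeanClass.mk_surjective K c

theorem archValuation_natCast_add_one (n : ℕ) : archValuation K ((n : K) + 1) = 1 := by
  rw [archValuation_eq_one_iff]
  exact_mod_cast ArchimedeanClass.mk_natCast (S := K) n.succ_ne_zero

/-- Every radius is the value of some element, so valuation balls are ultrametric balls; pairwise
meeting ones are nested. -/
theorem BallSpace.SphericallyComplete.ballComplete
    (h : (hybridBallSpace K).SphericallyComplete) : (archValuation K).BallComplete := by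
  intro S hS
  rcases S.eq_empty_or_nonempty with rfl | hne
  · exact ⟨0, by simp⟩
  obtain ⟨z, hz⟩ := h ((fun p ↦ {z | archValuation K (z - p.1) ≤ p.2}) '' S) ⟨hne.image _, by
    rintro _ ⟨p, hp, rfl⟩
    obtain ⟨w, hw⟩ := archValuation_surjective p.2
    refine Or.inl ⟨p.1, p.1 - w, ?_⟩
    ext z
    simp only [ultrametricBall, Set.mem_ofPred_eq]
    rw [← archValuation_le_iff, sub_sub_cancel, hw, Valuation.map_sub_swap], by
    rintro _ ⟨p, hp, rfl⟩ _ ⟨q, hq, rfl⟩ -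
    rcases le_total p.2 q.2 with hpq | hpq
    · left
      intro z hz
      rw [Set.mem_ofPred_eq] at hz ⊢
      have := Valuation.map_add_le _ (hz.trans hpq) ((hS p hp q hq).trans_eq (max_eq_right hpq))
      rwa [sub_add_sub_cancel] at this
    · right
      intro z hz
      rw [Set.mem_ofPred_eq] at hz ⊢
      have := Valuation.map_add_le _ (hz.trans hpq) ((hS q hq p hp).trans_eq (max_eq_right hpq))
      rwa [sub_add_sub_cancel] at this⟩
  exact ⟨z, fun p hp ↦ hz _ ⟨p, hp, rfl⟩⟩

theorem BallSpace.SphericallyComplete.exists_stdPart_eq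
    (h : (hybridBallSpace K).SphericallyComplete) (α : ℝ) :
    ∃ z : K, 0 ≤ ArchimedeanClass.mk z ∧ ArchimedeanClass.stdPart z = α := by
  have hq (n : ℕ) : ∃ q : ℚ, |α - q| < (1 / 4) ^ n := by
    obtain ⟨q, hq1, hq2⟩ := exists_rat_btwn (show α < α + (1 / 4) ^ n by simp)
    refine ⟨q, ?_⟩
    rw [abs_sub_lt_iff]
    constructor <;> linarith [show (0 : ℝ) < (1 / 4) ^ n by positivity]
  choose q hq using hq
  -- The factor 2 nests the intervals: the centers move by at most 5/4 of (1/4)^n and the next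
  -- radius is 1/2 of it.
  let r (n : ℕ) : ℚ := 2 * (1 / 4) ^ n
  have hr (n) : 0 < r n := by positivity
  have hstep (n) : |q n - q (n + 1)| + r (n + 1) ≤ r n := by
    have h1 := abs_lt.1 (hq n)
    have h2 := abs_lt.1 (hq (n + 1))
    have h3 : |(q n : ℝ) - q (n + 1)| ≤ (1 / 4) ^ n + (1 / 4) ^ (n + 1) := by
      rw [abs_sub_le_iff]; constructor <;> linarith
    have h4 : |q n - q (n + 1)| ≤ (1 / 4) ^ n + (1 / 4) ^ (n + 1) := by
      have := (Rat.cast_le (K := ℝ)).1 (show ((|q n - q (n + 1)| : ℚ) : ℝ) ≤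
        (((1 / 4) ^ n + (1 / 4) ^ (n + 1) : ℚ) : ℝ) by push_cast; exact h3)
      exact this
    have h5 : (0 : ℚ) < (1 / 4) ^ n := by positivity
    simp only [r]
    rw [pow_succ] at h4 ⊢
    linarith
  let B (n : ℕ) : Set K := orderBall (q n : K) (r n : K)
  have hB : Antitone B := by
    refine antitone_nat_of_succ_le fun n z (hz : |_| ≤ _) ↦ ?_
    have h1 : |(q n : K) - q (n + 1)| + r (n + 1) ≤ r n := by exact_mod_cast hstep n
    change |_| ≤ _
    linarith [abs_sub_le (q n : K) (q (n + 1)) z]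
  obtain ⟨z, hz⟩ := h (Set.range B) ⟨Set.range_nonempty B, by
    rintro _ ⟨n, rfl⟩
    exact Or.inr ⟨q n, r n, hr n, rfl⟩, hB.isChain_range⟩
  have hz' (n) : ((q n - r n : ℚ) : K) ≤ z ∧ z ≤ ((q n + r n : ℚ) : K) := by
    have : |(q n : K) - z| ≤ r n := hz _ ⟨n, rfl⟩
    rw [abs_sub_le_iff] at this
    push_cast
    constructor <;> linarith
  have hmk : 0 ≤ ArchimedeanClass.mk z :=
    (le_min (ArchimedeanClass.mk_ratCast_nonneg _) (ArchimedeanClass.mk_ratCast_nonneg _)).trans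
      (ArchimedeanClass.min_le_mk_of_le_of_le (hz' 0).1 (hz' 0).2)
  refine ⟨z, hmk, ?_⟩
  have hbd (n) : |ArchimedeanClass.stdPart z - α| ≤ 3 * (1 / 4) ^ n := by
    have h1 := ArchimedeanClass.stdPart_monotoneOn (ArchimedeanClass.mk_ratCast_nonneg _) hmk
      (hz' n).1
    have h2 := ArchimedeanClass.stdPart_monotoneOn hmk (ArchimedeanClass.mk_ratCast_nonneg _)
      (hz' n).2
    have h3 := abs_lt.1 (hq n)
    rw [ArchimedeanClass.stdPart_ratCast] at h1 h2
    simp only [r] at h1 h2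
    push_cast at h1 h2
    rw [abs_sub_le_iff]
    constructor <;> linarith
  by_contra hne
  obtain ⟨n, hn⟩ := exists_pow_lt_of_lt_one
    (show 0 < |ArchimedeanClass.stdPart z - α| / 3 from
      div_pos (abs_pos.2 (sub_ne_zero.2 hne)) (by norm_num)) (show (1 / 4 : ℝ) < 1 by norm_num)
  linarith [hbd n]

variable (K) in
/-- The graph of the standard part map on the finite elements. -/
noncomputable def stdPartGraph : Subring (K × ℝ) where
  carrier := {x | 0 ≤ ArchimedeanClass.mk x.1 ∧ ArchimedeanClass.stdPart x.1 = x.2}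
  mul_mem' {x y} hx hy := by
    refine ⟨?_, ?_⟩
    · simpa using add_nonneg hx.1 hy.1
    · simpa [hx.2, hy.2] using ArchimedeanClass.stdPart_mul hx.1 hy.1
  one_mem' := by simp
  add_mem' {x y} hx hy := by
    refine ⟨?_, ?_⟩
    · exact (le_min hx.1 hy.1).trans (ArchimedeanClass.min_le_mk_add _ _)
    · simpa [hx.2, hy.2] using ArchimedeanClass.stdPart_add hx.1 hy.1
  zero_mem' := by simp
  neg_mem' {x} hx := by
    refine ⟨?_, ?_⟩
    · simpa using hx.1
    · simp [hx.2]

theorem archValuation_eq_one_of_mem_stdPartGraph {x : K × ℝ} (hx : x ∈ stdPartGraph K)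
    (h : x.2 ≠ 0) : archValuation K x.1 = 1 := by
  by_contra hne
  rw [archValuation_eq_one_iff] at hne
  exact h (hx.2 ▸ ArchimedeanClass.stdPart_eq_zero.2 hne)

theorem archValuation_lt_one_of_mem_stdPartGraph {x : K × ℝ} (hx : x ∈ stdPartGraph K)
    (h : x.2 = 0) : archValuation K x.1 < 1 := by
  rw [archValuation_lt_one_iff]
  exact lt_of_le_of_ne hx.1 (ArchimedeanClass.stdPart_eq_zero.1 (hx.2.trans h)).symm

theorem mem_stdPartGraph_of_sub_lt {a b : K} {α : ℝ} (ha : (a, α) ∈ stdPartGraph K)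
    (hba : archValuation K (b - a) < 1) : (b, α) ∈ stdPartGraph K := by
  rw [archValuation_lt_one_iff] at hba
  have hb : b = (b - a) + a := by ring
  refine ⟨?_, ?_⟩
  · rw [hb]
    exact (le_min hba.le ha.1).trans (ArchimedeanClass.min_le_mk_add _ _)
  · change ArchimedeanClass.stdPart b = α
    rw [hb, ArchimedeanClass.stdPart_add_eq_right hba]
    exact ha.2

theorem Subring.eval₂_subtype_mem {R : Type*} [CommRing R] {G S : Subring R} (hGS : G ≤ S) {b : R}
    (hb : b ∈ S) (q : G[X]) : q.eval₂ G.subtype b ∈ S := by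
  rw [eval₂_eq_sum]
  exact sum_mem fun i _ ↦ mul_mem (hGS (q.coeff i).2) (pow_mem hb i)

/-- If the natural valuation is ball complete and its residue field is `ℝ`, then `ℝ` embeds in the
field. -/
theorem Valuation.BallComplete.nonempty_real_ringHom (hv : (archValuation K).BallComplete)
    (hres : ∀ α : ℝ, ∃ z : K, (z, α) ∈ stdPartGraph K) : Nonempty (ℝ →+* K) := by
  -- The second condition makes `G` the graph of a partial section of the standard part map.
  obtain ⟨G, -, hG, hmax⟩ := Subring.exists_maximal_of_forall
    (fun x : K × ℝ ↦ x ∈ stdPartGraph K ∧ (x.2 = 0 → x.1 = 0)) ⊥ (by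
      intro x hx
      obtain ⟨n, rfl⟩ := Subring.mem_bot.1 hx
      refine ⟨intCast_mem _ n, fun h0 ↦ ?_⟩
      have : n = 0 := by simpa using h0
      simp [this])
  have hGS : G ≤ stdPartGraph K := fun x hx ↦ (hG x hx).1
  let φ : G →+* K := (RingHom.fst K ℝ).comp G.subtype
  let ψ : G →+* ℝ := (RingHom.snd K ℝ).comp G.subtype
  have hψ : Function.Injective ψ := by
    rw [injective_iff_map_eq_zero]
    exact fun x hx ↦ Subtype.ext (Prod.ext ((hG x x.2).2 hx) hx)
  have hφ : Function.Injective φ := by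
    rw [injective_iff_map_eq_zero]
    intro x hx
    have hx' : (x : K × ℝ).1 = 0 := hx
    refine Subtype.ext (Prod.ext hx ?_)
    rw [← (hGS x.2).2, hx', ArchimedeanClass.stdPart_zero]
    rfl
  have hev (q : G[X]) (a α) : q.eval₂ G.subtype (a, α) = (q.eval₂ φ a, q.eval₂ ψ α) :=
    Prod.ext (hom_eval₂ q G.subtype (RingHom.fst K ℝ) (a, α))
      (hom_eval₂ q G.subtype (RingHom.snd K ℝ) (a, α))
  have hmem (q : G[X]) {a α} (ha : (a, α) ∈ stdPartGraph K) :
      (q.eval₂ φ a, q.eval₂ ψ α) ∈ stdPartGraph K := by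
    rw [← hev]
    exact Subring.eval₂_subtype_mem hGS ha q
  have hmem' {a α} (ha : (a, α) ∈ stdPartGraph K)
      (h : ∀ q : G[X], q.eval₂ ψ α = 0 → q.eval₂ φ a = 0) : (a, α) ∈ G :=
    hmax _ fun q ↦ by
      rw [hev]
      exact ⟨hmem q ha, h q⟩
  have hs : Function.Surjective ψ := by
    intro α
    suffices ∃ a, (a, α) ∈ G by
      obtain ⟨a, ha⟩ := this
      exact ⟨⟨_, ha⟩, rfl⟩
    obtain ⟨a, ha⟩ := hres α
    -- If `α` is transcendental over `G`, any lift `a` works. Otherwise a relation of least degree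
    -- has `α` as a simple root, which Hensel lifts.
    by_cases hall : ∀ q : G[X], q.eval₂ ψ α = 0 → q = 0
    · exact ⟨a, hmem' ha fun q hq ↦ by rw [hall q hq, eval₂_zero]⟩
    let N : Set ℕ := {n | ∃ p : G[X], p.natDegree = n ∧ p.eval₂ ψ α = 0 ∧ p ≠ 0}
    have hN : N.Nonempty := by
      push Not at hall
      obtain ⟨p, hp, hp'⟩ := hall
      exact ⟨_, p, rfl, hp, hp'⟩
    obtain ⟨p, hpn, hp, hp0⟩ := WellFounded.min_mem wellFounded_lt N hN
    have hlow (q : G[X]) (hq : q.natDegree < p.natDegree) (h0 : q.eval₂ ψ α = 0) : q = 0 := by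
      by_contra hc
      exact WellFounded.not_lt_min wellFounded_lt N ⟨q, rfl, h0, hc⟩ (hpn ▸ hq)
    have hpd : p.natDegree ≠ 0 := by
      intro h0
      rw [eq_C_of_natDegree_eq_zero h0, eval₂_C] at hp
      apply hp0
      rw [eq_C_of_natDegree_eq_zero h0, (injective_iff_map_eq_zero ψ).1 hψ _ hp, C_0]
    have hder : (derivative p).eval₂ ψ α ≠ 0 := by
      intro h0
      have h1 := hlow _ (natDegree_derivative_lt hpd) h0
      have h2 : derivative (p.map ψ) = 0 := by rw [derivative_map, h1, Polynomial.map_zero]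
      have h3 := derivative_eq_zero.1 h2
      rw [natDegree_map_eq_of_injective hψ] at h3
      exact hpd h3
    obtain ⟨b, hb, hba⟩ := hv.hensel (p.map φ) a
      (fun i ↦ by rw [coeff_map]; exact (hGS (p.coeff i).2).1)
      ha.1
      (by rw [eval_map]; exact archValuation_lt_one_of_mem_stdPartGraph (hmem p ha) hp)
      (by
        rw [derivative_map, eval_map]
        exact archValuation_eq_one_of_mem_stdPartGraph (hmem _ ha) hder)
    refine ⟨b, hmem' (mem_stdPartGraph_of_sub_lt ha hba) fun q hq ↦ ?_⟩
    obtain ⟨k, s, r, hqr, hr⟩ := exists_pseudo_division p hpd q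
    have e1 := congr(eval₂ ψ α $hqr)
    simp only [eval₂_mul, eval₂_add, hp, hq, mul_zero, zero_add] at e1
    have e2 := congr(eval₂ φ b $hqr)
    rw [eval_map] at hb
    simp only [eval₂_mul, eval₂_add, hb, hlow r hr e1.symm, eval₂_zero, mul_zero,
      zero_add] at e2
    refine (mul_eq_zero.1 e2).resolve_left ?_
    rw [eval₂_C, map_pow]
    refine pow_ne_zero _ ?_
    rw [_root_.map_ne_zero_iff _ hφ]
    exact leadingCoeff_ne_zero.2 hp0
  exact ⟨φ.comp (RingEquiv.ofBijective ψ ⟨hψ, hs⟩).symm.toRingHom⟩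

theorem RingHom.monotone_of_real (f : ℝ →+* K) : Monotone f := by
  intro x y hxy
  have : f y - f x = f √(y - x) * f √(y - x) := by
    rw [← map_mul, Real.mul_self_sqrt (sub_nonneg.2 hxy), map_sub]
  have := mul_self_nonneg (f √(y - x))
  linarith

theorem mem_stdPartGraph_of_real (f : ℝ →+* K) (r : ℝ) : (f r, r) ∈ stdPartGraph K :=
  ⟨ArchimedeanClass.mk_map_nonneg_of_archimedean ⟨f, f.monotone_of_real⟩ r,
    ArchimedeanClass.stdPart_map_real ⟨f, f.monotone_of_real⟩ r⟩

/-- The real `n`-th root of the standard part is a simple approximate root of `X ^ n - x`, and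
Hensel corrects it. This is the divisibility behind the cross-section. -/
theorem Valuation.BallComplete.exists_pow_eq (hv : (archValuation K).BallComplete) (f : ℝ →+* K)
    {x : K} (hx : 0 < x) (hx' : ArchimedeanClass.mk x = 0) {n : ℕ} (hn : n ≠ 0) :
    ∃ y : K, 0 < y ∧ ArchimedeanClass.mk y = 0 ∧ y ^ n = x := by
  set c := ArchimedeanClass.stdPart x
  have hc : 0 < c :=
    lt_of_le_of_ne (ArchimedeanClass.stdPart_nonneg hx.le) (by simp [c, eq_comm, hx'])
  set s := c ^ (n : ℝ)⁻¹
  have hs : 0 < s := Real.rpow_pos_of_pos hc _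
  have hsn : s ^ n = c := Real.rpow_inv_natCast_pow hc.le hn
  have hxm : (x, c) ∈ stdPartGraph K := ⟨hx'.ge, rfl⟩
  have hsm := mem_stdPartGraph_of_real f s
  obtain ⟨b, hb, hbs⟩ := hv.hensel (X ^ n - C x) (f s)
    (fun i ↦ by
      rw [coeff_sub, coeff_X_pow, coeff_C]
      refine Valuation.map_sub_le _ ?_ ?_
      · split_ifs <;> simp
      · split_ifs
        · exact hx'.ge
        · simp)
    hsm.1
    (by
      have := sub_mem (pow_mem hsm n) hxm
      have := archValuation_lt_one_of_mem_stdPartGraph this (by simp [hsn])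
      simpa using this)
    (by
      have := mul_mem (natCast_mem (stdPartGraph K) n) (pow_mem hsm (n - 1))
      have := archValuation_eq_one_of_mem_stdPartGraph this
        (by simpa [hn] using fun h ↦ absurd h hs.ne')
      simpa [derivative_X_pow] using this)
  have hbm := mem_stdPartGraph_of_sub_lt hsm hbs
  refine ⟨b, ?_, ?_, ?_⟩
  · by_contra hb0
    have : ArchimedeanClass.stdPart b ≤ 0 := ArchimedeanClass.stdPart_nonpos (not_lt.1 hb0)
    rw [hbm.2] at this
    exact this.not_gt hs
  · exact archValuation_eq_one_iff.1 (archValuation_eq_one_of_mem_stdPartGraph hbm hs.ne')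
  · simpa [sub_eq_zero] using hb

end OrderedFieldValuation

/-! ### A group of monomials -/

section MonomialGroup

variable {K : Type u} [Field K] [LinearOrder K] [IsStrictOrderedRing K]

/-- If the group of positive units of the natural valuation is divisible, then the valuation has a
cross-section with positive values. -/
theorem exists_crossSection
    (hdiv : ∀ x : K, 0 < x → ArchimedeanClass.mk x = 0 → ∀ n : ℕ, n ≠ 0 →
      ∃ y : K, 0 < y ∧ ArchimedeanClass.mk y = 0 ∧ y ^ n = x) :
    ∃ (Γ : Type u) (_ : AddCommGroup Γ) (_ : LinearOrder Γ) (_ : IsOrderedAddMonoid Γ)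
      (τ : Multiplicative Γ →* K), (∀ γ, 0 < τ γ) ∧
      StrictMono (fun γ : Γ ↦ ArchimedeanClass.mk (τ (.ofAdd γ))) ∧
      ∀ x : K, x ≠ 0 → ∃ γ : Γ, ArchimedeanClass.mk (τ (.ofAdd γ)) = ArchimedeanClass.mk x := by
  let H := {x : K // 0 < x}
  let U : Subgroup H :=
    { carrier := {x | ArchimedeanClass.mk (x : K) = 0}
      mul_mem' := fun {x y} (hx : _ = _) (hy : _ = _) ↦ by
        change ArchimedeanClass.mk ((x : K) * y) = 0
        rw [ArchimedeanClass.mk_mul, hx, hy, add_zero]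
      one_mem' := ArchimedeanClass.mk_one
      inv_mem' := fun {x} (hx : _ = _) ↦ by
        change ArchimedeanClass.mk (x : K)⁻¹ = 0
        rw [ArchimedeanClass.mk_inv, hx, neg_zero] }
  let _ : DivisibleBy (Additive U) ℕ := divisibleByOfSMulRightSurj _ _ (by
    intro n hn x
    obtain ⟨y, hy, hy', hyx⟩ := hdiv x.toMul.1.1 x.toMul.1.2 x.toMul.2 n hn
    refine ⟨.ofMul ⟨⟨y, hy⟩, hy'⟩, ?_⟩
    exact congrArg Additive.ofMul (Subtype.ext (Subtype.ext hyx)))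
  let _ : DivisibleBy (Additive U) ℤ := AddGroup.divisibleByIntOfDivisibleByNat _
  -- A divisible abelian group is injective, so the identity of `U` extends to a retraction; its
  -- kernel is a complement of `U`.
  obtain ⟨ρ', hρ'⟩ := (Module.Baer.of_divisible (Additive U)).extension_property_addMonoidHom
    (MonoidHom.toAdditive U.subtype) (fun x y h ↦ Subtype.ext h) (AddMonoidHom.id _)
  let ρ : H →* U := AddMonoidHom.toMultiplicative ρ'
  have hρ (u : U) : ρ u = u := DFunLike.congr_fun hρ' (Additive.ofMul u)
  let T : Subgroup H := ρ.ker
  have hTU (t : H) (ht : t ∈ T) (hu : t ∈ U) : t = 1 := by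
    have h1 : ρ t = 1 := ht
    have h2 := hρ ⟨t, hu⟩
    rw [h1] at h2
    exact congrArg Subtype.val h2.symm
  -- `T` keeps the order of `K`, while classes decrease as elements grow; inversion makes `τ`
  -- strictly increasing on classes.
  let τ : Multiplicative (Additive T) →* K :=
    { toFun := fun γ ↦ ((γ.toAdd.toMul : H) : K)⁻¹
      map_one' := inv_one
      map_mul' := fun x y ↦ mul_inv _ _ }
  refine ⟨Additive T, inferInstance, inferInstance, inferInstance, τ,
    fun γ ↦ inv_pos.2 γ.toAdd.toMul.1.2, ?_, ?_⟩
  · intro x y hxy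
    have hx : 0 < ((x.toMul : H) : K) := x.toMul.1.2
    have hy : 0 < ((y.toMul : H) : K) := y.toMul.1.2
    have hlt : ((x.toMul : H) : K) < ((y.toMul : H) : K) := hxy
    change ArchimedeanClass.mk ((x.toMul : H) : K)⁻¹ < ArchimedeanClass.mk ((y.toMul : H) : K)⁻¹
    refine lt_of_le_of_ne (ArchimedeanClass.mk_antitoneOn (inv_pos.2 hy).le (inv_pos.2 hx).le
      (inv_anti₀ hx hlt.le)) fun he ↦ ?_
    have hu : (x.toMul : H)⁻¹ * y.toMul ∈ U := by
      change ArchimedeanClass.mk (((x.toMul : H) : K)⁻¹ * ((y.toMul : H) : K)) = 0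
      rw [ArchimedeanClass.mk_mul, he, ← ArchimedeanClass.mk_mul, inv_mul_cancel₀ hy.ne',
        ArchimedeanClass.mk_one]
    have := hTU _ (T.mul_mem (T.inv_mem x.toMul.2) y.toMul.2) hu
    rw [inv_mul_eq_one] at this
    exact hlt.ne (congrArg Subtype.val this)
  · intro x hx
    let h : H := ⟨|x|, abs_pos.2 hx⟩
    have ht : (ρ h : H) * h⁻¹ ∈ T := by
      rw [MonoidHom.mem_ker, map_mul, hρ, map_inv, mul_inv_cancel]
    refine ⟨Additive.ofMul ⟨_, ht⟩, ?_⟩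
    change ArchimedeanClass.mk ((((ρ h : H) : K) * |x|⁻¹)⁻¹) = _
    have hu : ArchimedeanClass.mk ((ρ h : H) : K) = 0 := (ρ h).2
    rw [mul_inv, inv_inv, ArchimedeanClass.mk_mul, ArchimedeanClass.mk_inv, hu, neg_zero, zero_add,
      ArchimedeanClass.mk_abs]

end MonomialGroup

/-! ### Ball completeness of Hahn series -/

section HahnSeries

variable {Γ : Type*} [LinearOrder Γ]

theorem HahnSeries.lt_orderTop_iff_forall {R : Type*} [Zero R] {x : HahnSeries Γ R} {γ : Γ} :
    γ < x.orderTop ↔ ∀ i ≤ γ, x.coeff i = 0 := by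
  refine ⟨fun h i hi ↦ coeff_eq_zero_of_lt_orderTop ((WithTop.coe_le_coe.2 hi).trans_lt h),
    fun h ↦ ?_⟩
  by_contra! hc
  obtain ⟨g, hg⟩ := WithTop.ne_top_iff_exists.1 (hc.trans_lt (WithTop.coe_lt_top γ)).ne
  rw [← hg, WithTop.coe_le_coe] at hc
  exact coeff_orderTop_ne hg.symm (h g hc)

/-- Families of pairwise intersecting balls of Hahn series have a common point. -/
theorem HahnSeries.exists_forall_le_orderTop_sub {R : Type*} [AddGroup R]
    (S : Set (HahnSeries Γ R × WithTop Γ))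
    (hS : ∀ p ∈ S, ∀ q ∈ S, min p.2 q.2 ≤ (p.1 - q.1).orderTop) :
    ∃ z, ∀ p ∈ S, p.2 ≤ (z - p.1).orderTop := by
  classical
  -- Any ball whose radius exceeds `γ` prescribes the same coefficient there; all others are set to
  -- 0.
  let c (γ : Γ) : R := if h : ∃ p ∈ S, γ < p.2 then h.choose.1.coeff γ else 0
  have hc {p} (hp : p ∈ S) {γ : Γ} (hγ : γ < p.2) : c γ = p.1.coeff γ := by
    have h : ∃ p ∈ S, γ < p.2 := ⟨p, hp, hγ⟩
    simp only [c, dif_pos h]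
    have := coeff_eq_zero_of_lt_orderTop
      ((lt_min h.choose_spec.2 hγ).trans_le (hS _ h.choose_spec.1 _ hp))
    rwa [coeff_sub, sub_eq_zero] at this
  have hc0 {γ : Γ} (hγ : c γ ≠ 0) : ∃ p ∈ S, γ < p.2 := by
    by_contra h
    exact hγ (dif_neg h)
  -- A descending sequence in the support stays below the radius bounding its first term, so it
  -- would descend in the support of a single center.
  have hwf : (Function.support c).IsPWO := by
    refine Set.IsWF.isPWO (Set.isWF_iff_no_descending_seq.2 fun f hf hfc ↦ ?_)
    obtain ⟨p, hp, hpf⟩ := hc0 (hfc 0)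
    refine Set.isWF_iff_no_descending_seq.1 p.1.isWF_support f hf fun n ↦ ?_
    have h : (f n : WithTop Γ) < p.2 :=
      (WithTop.coe_le_coe.2 (hf.antitone (Nat.zero_le n))).trans_lt hpf
    have := hfc n
    rw [Function.mem_support, hc hp h] at this
    exact this
  refine ⟨⟨c, hwf⟩, fun p hp ↦ le_orderTop_iff_forall.2 fun γ hγ ↦ ?_⟩
  rw [coeff_sub]
  exact sub_eq_zero.2 (hc hp hγ)

theorem HahnSeries.exists_single_sub_lt [Zero Γ] {f : HahnSeries Γ ℝ} (hf : f ≠ 0) :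
    ∃ (γ : Γ) (r : ℝ), f.orderTop < (f - single γ r).orderTop := by
  refine ⟨f.order, f.leadingCoeff, ?_⟩
  rw [← order_eq_orderTop_of_ne_zero hf, lt_orderTop_iff_forall]
  intro i hi
  rw [coeff_sub]
  rcases hi.eq_or_lt with rfl | hi
  · rw [coeff_single_same, leadingCoeff_eq, sub_self]
  · rw [coeff_single_of_ne hi.ne, coeff_eq_zero_of_lt_order hi, sub_zero]

theorem HahnSeries.zero_lt_toLex_of_orderTop_lt {f : HahnSeries Γ ℝ} {γ : Γ} {r : ℝ}
    (hr : 0 < r) (h : γ < (f - single γ r).orderTop) : 0 < toLex f := by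
  rw [lt_orderTop_iff_forall] at h
  rw [lt_iff]
  refine ⟨γ, fun j hj ↦ ?_, ?_⟩
  · have := h j hj.le
    rw [coeff_sub, coeff_single_of_ne hj.ne, sub_zero] at this
    exact this.symm
  · have := h γ le_rfl
    rw [coeff_sub, coeff_single_same, sub_eq_zero] at this
    change 0 < f.coeff γ
    rwa [this]

end HahnSeries

/-- Terms of distinct value cannot cancel. This evaluates elements of the group algebra in both
fields. -/
theorem Valuation.map_sum_of_injOn {R ι Γ₀ : Type*} [Ring R] [LinearOrderedCommGroupWithZero Γ₀]
    (v : Valuation R Γ₀) (s : Finset ι) (f : ι → R) (h : Set.InjOn (fun i ↦ v (f i)) s) :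
    v (∑ i ∈ s, f i) = s.sup fun i ↦ v (f i) := by
  classical
  rcases s.eq_empty_or_nonempty with rfl | hs
  · rw [Finset.sum_empty, Finset.sup_empty, map_zero]
    exact le_antisymm zero_le bot_le
  obtain ⟨j, hj, hmax⟩ := s.exists_max_image (fun i ↦ v (f i)) hs
  rw [v.map_sum_eq_of_lt hj]
  · exact le_antisymm (Finset.le_sup (f := fun i ↦ v (f i)) hj) (Finset.sup_le hmax)
  · intro i hi
    rw [Finset.mem_sdiff, Finset.mem_singleton] at hi
    exact lt_of_le_of_ne (hmax i hi.1) fun he ↦ hi.2 (h hi.1 hj he)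

/-! ### Comparison with the power series field -/

section PowerSeries

variable {K : Type u} [Field K] [LinearOrder K] [IsStrictOrderedRing K]
  {Γ : Type*} [AddCommGroup Γ]

/-- The map from exponents to archimedean classes given by a multiplicative family of monomials. -/
noncomputable def monomialClass (τ : Multiplicative Γ →* K) :
    WithTop Γ →+ ArchimedeanClass K where
  toFun := WithTop.recTopCoe ⊤ fun γ ↦ ArchimedeanClass.mk (τ (.ofAdd γ))
  map_zero' := by
    change ArchimedeanClass.mk (τ 1) = 0
    rw [map_one, ArchimedeanClass.mk_one]
  map_add' x y := by
    induction x with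
    | top => exact (top_add _).symm
    | coe x =>
      induction y with
      | top => exact (add_top _).symm
      | coe y =>
        change ArchimedeanClass.mk (τ (.ofAdd x * .ofAdd y)) = _
        rw [map_mul, ArchimedeanClass.mk_mul]
        rfl

theorem monomialClass_coe (τ : Multiplicative Γ →* K) (γ : Γ) :
    monomialClass τ γ = ArchimedeanClass.mk (τ (.ofAdd γ)) := rfl

theorem monomialClass_top (τ : Multiplicative Γ →* K) : monomialClass τ ⊤ = ⊤ := rfl

theorem monomialClass_surjective {τ : Multiplicative Γ →* K}
    (hsurj : ∀ x : K, x ≠ 0 → ∃ γ : Γ, ArchimedeanClass.mk (τ (.ofAdd γ)) = ArchimedeanClass.mk x) :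
    Function.Surjective (monomialClass τ) := by
  intro c
  obtain ⟨x, rfl⟩ := ArchimedeanClass.mk_surjective K c
  rcases eq_or_ne x 0 with rfl | hx
  · exact ⟨⊤, ArchimedeanClass.mk_zero.symm⟩
  · obtain ⟨γ, hγ⟩ := hsurj x hx
    exact ⟨γ, hγ⟩

/-- With `t` the monomial in the class of `a` and `r` the standard part of `a / t`, the difference
`a / t - r` is infinitesimal. This is immediacy; the sign of `r` will give the order. -/
theorem exists_monomial_sub_lt {τ : Multiplicative Γ →* K} (ι : ℝ →+* K) (hpos : ∀ γ, 0 < τ γ)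
    (hsurj : ∀ x : K, x ≠ 0 → ∃ γ : Γ, ArchimedeanClass.mk (τ (.ofAdd γ)) = ArchimedeanClass.mk x)
    {a : K} (ha : a ≠ 0) :
    ∃ (γ : Γ) (r : ℝ), archValuation K (a - ι r * τ (.ofAdd γ)) < archValuation K a ∧
      archValuation K (τ (.ofAdd γ)) = archValuation K a ∧ (0 < a → 0 < r) := by
  obtain ⟨γ, hγ⟩ := hsurj a ha
  set t := τ (.ofAdd γ) with ht
  have ht0 : 0 < t := hpos _
  have hat : ArchimedeanClass.mk (a / t) = 0 := by
    have h1 : archValuation K (a / t) = 1 := by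
      rw [map_div₀, show archValuation K t = archValuation K a from hγ, div_self]
      exact (archValuation K).ne_zero_iff.2 ha
    exact archValuation_eq_one_iff.1 h1
  have hγ' : archValuation K t = archValuation K a := hγ
  refine ⟨γ, ArchimedeanClass.stdPart (a / t), ?_, hγ', fun ha0 ↦ ?_⟩
  · have hm : (a / t, ArchimedeanClass.stdPart (a / t)) ∈ stdPartGraph K := ⟨hat.ge, rfl⟩
    have h1 := archValuation_lt_one_of_mem_stdPartGraph
      (sub_mem hm (mem_stdPartGraph_of_real ι (ArchimedeanClass.stdPart (a / t)))) (sub_self _)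
    have e : a - ι (ArchimedeanClass.stdPart (a / t)) * t =
        (a / t - ι (ArchimedeanClass.stdPart (a / t))) * t := by
      rw [sub_mul, div_mul_cancel₀ _ ht0.ne']
    rw [e, map_mul, ← hγ']
    exact mul_lt_of_lt_one_left ((archValuation K).pos_iff.2 ht0.ne') h1
  · exact lt_of_le_of_ne (ArchimedeanClass.stdPart_nonneg (div_pos ha0 ht0).le)
      fun h ↦ ArchimedeanClass.stdPart_eq_zero.1 h.symm hat

variable [LinearOrder Γ]

theorem monomialClass_strictMono {τ : Multiplicative Γ →* K} (hpos : ∀ γ, 0 < τ γ)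
    (hτ : StrictMono fun γ : Γ ↦ ArchimedeanClass.mk (τ (.ofAdd γ))) :
    StrictMono (monomialClass τ) := by
  intro x y hxy
  induction x with
  | top => exact absurd hxy not_top_lt
  | coe x =>
    induction y with
    | top =>
      rw [monomialClass_coe, monomialClass_top, lt_top_iff_ne_top, Ne,
        ArchimedeanClass.mk_eq_top_iff]
      exact (hpos _).ne'
    | coe y => exact hτ (WithTop.coe_lt_coe.1 hxy)

variable [IsOrderedAddMonoid Γ]

/-- The order of vanishing of a power series, with values in the archimedean classes of `K`. -/
noncomputable def monomialValuation (τ : Multiplicative Γ →* K)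
    (hτ : StrictMono (monomialClass τ)) :
    Valuation (HahnSeries Γ ℝ) (Multiplicative (ArchimedeanClass K)ᵒᵈ) :=
  ((HahnSeries.addVal Γ ℝ).map (monomialClass τ) rfl hτ.monotone).toValuation

variable {τ : Multiplicative Γ →* K} {hτ : StrictMono (monomialClass τ)}

theorem monomialValuation_apply (f : HahnSeries Γ ℝ) :
    monomialValuation τ hτ f = .ofAdd (.toDual (monomialClass τ f.orderTop)) := rfl

theorem monomialValuation_le_iff {f : HahnSeries Γ ℝ} {x : WithTop Γ} :
    monomialValuation τ hτ f ≤ .ofAdd (.toDual (monomialClass τ x)) ↔ x ≤ f.orderTop :=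
  hτ.le_iff_le

theorem monomialValuation_lt_iff {f g : HahnSeries Γ ℝ} :
    monomialValuation τ hτ f < monomialValuation τ hτ g ↔ g.orderTop < f.orderTop :=
  hτ.lt_iff_lt

theorem monomialValuation_single (γ : Γ) {r : ℝ} (hr : r ≠ 0) :
    monomialValuation τ hτ (.single γ r) = archValuation K (τ (.ofAdd γ)) := by
  rw [monomialValuation_apply, HahnSeries.orderTop_single hr]
  rfl

theorem monomialValuation_ballComplete (hsurj : Function.Surjective (monomialClass τ)) :
    (monomialValuation τ hτ).BallComplete := by
  intro S hS
  have key (x y : WithTop Γ) : max (Multiplicative.ofAdd (OrderDual.toDual (monomialClass τ x)))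
      (.ofAdd (.toDual (monomialClass τ y))) = .ofAdd (.toDual (monomialClass τ (min x y))) := by
    rw [hτ.monotone.map_min]
    rfl
  obtain ⟨z, hz⟩ := HahnSeries.exists_forall_le_orderTop_sub
    {p : HahnSeries Γ ℝ × WithTop Γ | (p.1, .ofAdd (.toDual (monomialClass τ p.2))) ∈ S}
    (fun p hp q hq ↦ by
      have := hS _ hp _ hq
      rwa [key, monomialValuation_le_iff] at this)
  refine ⟨z, fun p hp ↦ ?_⟩
  obtain ⟨x, hx⟩ := hsurj p.2.toAdd.ofDual
  have hp2 : p.2 = .ofAdd (.toDual (monomialClass τ x)) := by rw [hx]; rfl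
  rw [hp2, monomialValuation_le_iff]
  refine hz (p.1, x) ?_
  change (p.1, _) ∈ S
  rwa [← hp2]

/-- The monomials of the field of power series. -/
noncomputable def HahnSeries.monomialHom (Γ : Type*) [AddCommGroup Γ] [LinearOrder Γ]
    [IsOrderedAddMonoid Γ] : Multiplicative Γ →* HahnSeries Γ ℝ where
  toFun γ := single γ.toAdd 1
  map_one' := rfl
  map_mul' x y := by rw [single_mul_single, one_mul, toAdd_mul]

theorem nonempty_orderRingIso_of_crossSection (hv : (archValuation K).BallComplete)
    (ι : ℝ →+* K) (τ : Multiplicative Γ →* K) (hpos : ∀ γ, 0 < τ γ)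
    (hτ : StrictMono fun γ : Γ ↦ ArchimedeanClass.mk (τ (.ofAdd γ)))
    (hsurj : ∀ x : K, x ≠ 0 →
      ∃ γ : Γ, ArchimedeanClass.mk (τ (.ofAdd γ)) = ArchimedeanClass.mk x) :
    Nonempty (K ≃+*o Lex (HahnSeries Γ ℝ)) := by
  have hτ' := monomialClass_strictMono hpos hτ
  let v' := monomialValuation τ hτ'
  have : CharZero (HahnSeries Γ ℝ) := inferInstanceAs (CharZero (Lex (HahnSeries Γ ℝ)))
  -- The range of this map into the product is the initial partial isomorphism, matching monomials.
  let Φ : AddMonoidAlgebra ℝ Γ →+* K × HahnSeries Γ ℝ :=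
    AddMonoidAlgebra.liftNCRingHom (ι.prod HahnSeries.C) (τ.prod (HahnSeries.monomialHom Γ))
      fun _ _ ↦ Commute.all _ _
  have hΦ_single (γ : Γ) (r : ℝ) : Φ (.single γ r) = (ι r * τ (.ofAdd γ), .single γ r) := by
    have h1 : Φ (.single γ r) = (ι.prod HahnSeries.C) r *
        (τ.prod (HahnSeries.monomialHom Γ)) (.ofAdd γ) := AddMonoidAlgebra.liftNC_single ..
    rw [h1]
    refine Prod.ext rfl ?_
    change HahnSeries.single 0 r * HahnSeries.single γ 1 = _
    rw [HahnSeries.single_mul_single, zero_add, mul_one]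
  have hι {r : ℝ} (hr : r ≠ 0) : archValuation K (ι r) = 1 :=
    archValuation_eq_one_of_mem_stdPartGraph (mem_stdPartGraph_of_real ι r) hr
  have hΦ (f) : archValuation K (Φ f).1 = v' (Φ f).2 := by
    have hf : f = ∑ γ ∈ f.coeff.support, AddMonoidAlgebra.single γ (f.coeff γ) :=
      (AddMonoidAlgebra.sum_coeff_single f).symm
    have h1 : (Φ f).1 = ∑ γ ∈ f.coeff.support, ι (f.coeff γ) * τ (.ofAdd γ) := by
      conv_lhs => rw [hf, map_sum, Prod.fst_sum]
      simp_rw [hΦ_single]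
    have h2 : (Φ f).2 = ∑ γ ∈ f.coeff.support, HahnSeries.single γ (f.coeff γ) := by
      conv_lhs => rw [hf, map_sum, Prod.snd_sum]
      simp_rw [hΦ_single]
    have h3 : ∀ γ ∈ f.coeff.support, archValuation K (ι (f.coeff γ) * τ (.ofAdd γ)) =
        archValuation K (τ (.ofAdd γ)) := fun γ hγ ↦ by
      rw [map_mul, hι (Finsupp.mem_support_iff.1 hγ), one_mul]
    have h4 : ∀ γ ∈ f.coeff.support, v' (.single γ (f.coeff γ)) =
        archValuation K (τ (.ofAdd γ)) := fun γ hγ ↦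
      monomialValuation_single γ (Finsupp.mem_support_iff.1 hγ)
    have hinj : Function.Injective fun γ : Γ ↦ archValuation K (τ (.ofAdd γ)) := hτ.injective
    rw [h1, h2, Valuation.map_sum_of_injOn, Valuation.map_sum_of_injOn]
    · exact Finset.sup_congr rfl fun γ hγ ↦ (h3 γ hγ).trans (h4 γ hγ).symm
    · exact hinj.injOn.congr fun γ hγ ↦ (h4 γ hγ).symm
    · exact hinj.injOn.congr fun γ hγ ↦ (h3 γ hγ).symm
  obtain ⟨e, he, heΦ⟩ := Valuation.exists_ringEquiv_of_immediate (v := archValuation K) (v' := v')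
    hv (monomialValuation_ballComplete (monomialClass_surjective hsurj))
    archValuation_natCast_add_one (fun n ↦ by
      have h1 : ((n : HahnSeries Γ ℝ) + 1) = .single 0 ((n : ℝ) + 1) := by
        change _ = HahnSeries.C ((n : ℝ) + 1)
        rw [map_add, map_natCast, map_one]
      rw [h1, monomialValuation_single _ (by positivity)]
      change archValuation K (τ 1) = 1
      simp) Φ.range
    (by rintro _ ⟨f, rfl⟩; exact hΦ f)
    (fun a ha ↦ by
      obtain ⟨γ, r, h, -⟩ := exists_monomial_sub_lt ι hpos hsurj ha
      exact ⟨_, ⟨.single γ r, rfl⟩, by rwa [hΦ_single]⟩)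
    (fun f hf ↦ by
      obtain ⟨γ, r, h⟩ := HahnSeries.exists_single_sub_lt hf
      exact ⟨_, ⟨.single γ r, rfl⟩, by rwa [hΦ_single, monomialValuation_lt_iff]⟩)
  -- Since `e` preserves values and fixes monomials, `e x` has the leading term of `x`, with `r >
  -- 0`.
  have hepos (x : K) (hx : 0 < x) : 0 < toLex (e x) := by
    obtain ⟨γ, r, h, hγ, hr⟩ := exists_monomial_sub_lt ι hpos hsurj hx.ne'
    have hr := hr hx
    refine HahnSeries.zero_lt_toLex_of_orderTop_lt (γ := γ) hr ?_
    have h1 := heΦ _ ⟨.single γ r, rfl⟩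
    rw [hΦ_single] at h1
    dsimp only at h1
    rw [← HahnSeries.orderTop_single (a := γ) hr.ne',
      ← monomialValuation_lt_iff (τ := τ) (hτ := hτ'), monomialValuation_single _ hr.ne', hγ,
      ← h1, ← map_sub e]
    exact (he _).trans_lt h
  have hmono : StrictMono fun x ↦ toLex (e x) := fun x y hxy ↦ by
    have := hepos _ (sub_pos.2 hxy)
    rw [map_sub, toLex_sub, sub_pos] at this
    exact this
  exact ⟨{ toFun := fun x ↦ toLex (e x)
           invFun := fun x ↦ e.symm (ofLex x)
           left_inv := fun x ↦ e.symm_apply_apply x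
           right_inv := fun x ↦ e.apply_symm_apply x
           map_mul' := fun x y ↦ map_mul e x y
           map_add' := fun x y ↦ map_add e x y
           map_le_map_iff' := hmono.le_iff_le }⟩

end PowerSeries

theorem BallSpace.SphericallyComplete.isoRealPowerSeriesField {K : Type u} [Field K]
    [LinearOrder K] [IsStrictOrderedRing K] (h : (hybridBallSpace K).SphericallyComplete) :
    IsoRealPowerSeriesField K := by
  have hv := h.ballComplete
  obtain ⟨ι⟩ := hv.nonempty_real_ringHom h.exists_stdPart_eq
  obtain ⟨Γ, i₁, i₂, i₃, τ, hpos, hτ, hsurj⟩ := exists_crossSection fun x hx hx' n hn ↦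
    hv.exists_pow_eq ι hx hx' hn
  exact ⟨Γ, i₁, i₂, i₃, nonempty_orderRingIso_of_crossSection hv ι τ hpos hτ hsurj⟩

/-! ### Spherical completeness of power series fields -/

section HybridBallSpace

variable {K : Type u} [Field K] [LinearOrder K] [IsStrictOrderedRing K]

theorem OrderRingIso.archimedeanClassMk_le_iff {L : Type*} [Field L] [LinearOrder L]
    [IsStrictOrderedRing L] (e : K ≃+*o L) {x y : K} :
    ArchimedeanClass.mk (e x) ≤ ArchimedeanClass.mk (e y) ↔
      ArchimedeanClass.mk x ≤ ArchimedeanClass.mk y := by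
  let f : K →+o L := ⟨(e.toRingEquiv : K →+* L).toAddMonoidHom, e.toOrderIso.monotone⟩
  let g : L →+o K := ⟨(e.symm.toRingEquiv : L →+* K).toAddMonoidHom, e.symm.toOrderIso.monotone⟩
  refine ⟨fun h ↦ ?_, fun h ↦ ArchimedeanClass.map_mk_le f h⟩
  have := ArchimedeanClass.map_mk_le g h
  rwa [show g (e x) = x from e.symm_apply_apply x,
    show g (e y) = y from e.symm_apply_apply y] at this

theorem exists_forall_mem_of_isChain_ultrametricBalls {Γ : Type*} [AddCommGroup Γ] [LinearOrder Γ]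
    [IsOrderedAddMonoid Γ] (e : K ≃+*o Lex (HahnSeries Γ ℝ)) {N : Set (Set K)}
    (hN : N ⊆ ultrametricBalls K) (hch : IsChain (· ⊆ ·) N) : ∃ z, ∀ B ∈ N, z ∈ B := by
  have hu (x y : K) : ArchimedeanClass.mk x ≤ ArchimedeanClass.mk y ↔
      (ofLex (e x)).orderTop ≤ (ofLex (e y)).orderTop := by
    rw [← HahnSeries.archimedeanClassOrderIsoWithTop_apply,
      ← HahnSeries.archimedeanClassOrderIsoWithTop_apply, OrderIso.le_iff_le]
    exact e.archimedeanClassMk_le_iff.symm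
  have hmem (x y z : K) : z ∈ ultrametricBall x y ↔
      (ofLex (e (x - y))).orderTop ≤ (ofLex (e (x - z))).orderTop := hu _ _
  have hswap (x y : K) : (ofLex (e (x - y))).orderTop = (ofLex (e (y - x))).orderTop := by
    rw [← neg_sub, map_neg, ofLex_neg, HahnSeries.orderTop_neg]
  have hsub {x y x' y' : K} (h : ultrametricBall x y ⊆ ultrametricBall x' y') :
      (ofLex (e (x' - y'))).orderTop ≤ (ofLex (e (x' - x))).orderTop := by
    rw [← hmem]
    refine h ((hmem _ _ _).2 ?_)
    simp
  obtain ⟨z, hz⟩ := HahnSeries.exists_forall_le_orderTop_sub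
    {p : HahnSeries Γ ℝ × WithTop Γ | ∃ x y, ultrametricBall x y ∈ N ∧
      p = (ofLex (e x), (ofLex (e (x - y))).orderTop)} (by
    rintro _ ⟨x, y, hB, rfl⟩ _ ⟨x', y', hB', rfl⟩
    dsimp only
    rw [← ofLex_sub, ← map_sub]
    rcases hch.total hB hB' with h | h
    · exact (min_le_right _ _).trans ((hsub h).trans_eq (hswap _ _))
    · exact (min_le_left _ _).trans (hsub h))
  refine ⟨e.symm (toLex z), fun B hB ↦ ?_⟩
  obtain ⟨x, y, rfl⟩ := hN hB
  have := hz _ ⟨x, y, hB, rfl⟩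
  rw [hmem, hswap x (e.symm _), map_sub e (e.symm _), OrderRingIso.apply_symm_apply, ofLex_sub]
  exact this

/-- In a nest every left endpoint is at most every right endpoint, so the real supremum of the left
endpoints, sent to `K`, lies in all balls. -/
theorem exists_forall_mem_of_isChain_rationalOrderBalls (f : ℝ →+* K) {N : Set (Set K)}
    (hN : N ⊆ rationalOrderBalls K) (hch : IsChain (· ⊆ ·) N) (hne : N.Nonempty) :
    ∃ z, ∀ B ∈ N, z ∈ B := by
  let I : Set (ℚ × ℚ) := {p | 0 < p.2 ∧ orderBall (p.1 : K) (p.2 : K) ∈ N}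
  have hsub {q r q' r' : ℚ} (hr : 0 < r)
      (h : orderBall (q : K) (r : K) ⊆ orderBall (q' : K) (r' : K)) : |q' - q| ≤ r' := by
    have h1 : (q : K) ∈ orderBall (q : K) (r : K) := by
      change |(q : K) - q| ≤ r
      rw [sub_self, abs_zero]
      exact_mod_cast hr.le
    have h2 : |(q' : K) - q| ≤ r' := h h1
    exact_mod_cast h2
  have hI {p p' : ℚ × ℚ} (hp : p ∈ I) (hp' : p' ∈ I) : p.1 - p.2 ≤ p'.1 + p'.2 := by
    have h1 := hp.1
    have h2 := hp'.1
    rcases hch.total hp.2 hp'.2 with h | h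
    · linarith [(abs_sub_le_iff.1 (hsub hp.1 h)).2]
    · linarith [(abs_sub_le_iff.1 (hsub hp'.1 h)).1]
  have hIne : I.Nonempty := by
    obtain ⟨B, hB⟩ := hne
    obtain ⟨q, r, hr, rfl⟩ := hN hB
    exact ⟨(q, r), hr, hB⟩
  let A : Set ℝ := (fun p : ℚ × ℚ ↦ ((p.1 - p.2 : ℚ) : ℝ)) '' I
  have hub {p : ℚ × ℚ} (hp : p ∈ I) : ((p.1 + p.2 : ℚ) : ℝ) ∈ upperBounds A := by
    rintro _ ⟨p', hp', rfl⟩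
    dsimp only
    exact_mod_cast hI hp' hp
  refine ⟨f (sSup A), fun B hB ↦ ?_⟩
  obtain ⟨q, r, hr, rfl⟩ := hN hB
  have hqr : (q, r) ∈ I := ⟨hr, hB⟩
  have h1 := f.monotone_of_real (le_csSup ⟨_, hub hqr⟩ (Set.mem_image_of_mem _ hqr))
  have h2 := f.monotone_of_real (csSup_le (hIne.image _ : A.Nonempty) (hub hqr))
  rw [map_ratCast] at h1 h2
  rw [Rat.cast_sub] at h1
  rw [Rat.cast_add] at h2
  change |_| ≤ _
  rw [abs_sub_le_iff]
  constructor <;> linarith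

/-- The points `q` and `q + r` differ by a nonzero rational, which is not infinitesimal. -/
theorem not_orderBall_subset_ultrametricBall {x y : K} {q r : ℚ} (hr : 0 < r)
    (hxy : 0 < ArchimedeanClass.mk (x - y)) :
    ¬ orderBall (q : K) (r : K) ⊆ ultrametricBall x y := by
  intro h
  have hr' : (0 : K) < r := by exact_mod_cast hr
  have h1 : (q : K) ∈ ultrametricBall x y := h (by
    change |(q : K) - q| ≤ r
    rw [sub_self, abs_zero]
    exact hr'.le)
  have h2 : (q + r : K) ∈ ultrametricBall x y := h (by
    change |(q : K) - (q + r)| ≤ r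
    rw [sub_add_cancel_left, abs_neg, abs_of_pos hr'])
  have h3 := (lt_min (hxy.trans_le h1) (hxy.trans_le h2)).trans_le
    (ArchimedeanClass.min_le_mk_sub (x - (q : K)) (x - (q + r)))
  rw [sub_sub_sub_cancel_left, add_sub_cancel_left, ArchimedeanClass.mk_ratCast hr.ne'] at h3
  exact h3.false

/-- Such a ball contains `x + n` for every natural `n`, and `n > 2 * r` exceeds the diameter. -/
theorem not_ultrametricBall_subset_orderBall {x y : K} {q r : ℚ}
    (hxy : ArchimedeanClass.mk (x - y) ≤ 0) :
    ¬ ultrametricBall x y ⊆ orderBall (q : K) (r : K) := by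
  intro h
  obtain ⟨n, hn⟩ := exists_nat_gt (2 * r)
  have h1 : |(q : K) - x| ≤ r := h (by
    change ArchimedeanClass.mk (x - y) ≤ ArchimedeanClass.mk (x - x)
    simp)
  have h2 : |(q : K) - (x + n)| ≤ r := h (by
    change ArchimedeanClass.mk (x - y) ≤ ArchimedeanClass.mk (x - (x + n))
    rw [sub_add_cancel_left, ArchimedeanClass.mk_neg]
    exact hxy.trans (ArchimedeanClass.mk_natCast_nonneg n))
  have h3 : 2 * (r : K) < n := by exact_mod_cast hn
  linarith [(abs_sub_le_iff.1 h1).1, (abs_sub_le_iff.1 h2).2]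

theorem IsoRealPowerSeriesField.sphericallyComplete (h : IsoRealPowerSeriesField K) :
    (hybridBallSpace K).SphericallyComplete := by
  obtain ⟨Γ, _, _, _, ⟨e⟩⟩ := h
  let f : ℝ →+* K := (e.symm : Lex (HahnSeries Γ ℝ) →+* K).comp
    (HahnSeries.C : ℝ →+* HahnSeries Γ ℝ)
  rintro N ⟨-, hNb, hch⟩
  obtain ⟨z, hz⟩ := exists_forall_mem_of_isChain_ultrametricBalls e
    (Set.inter_subset_right (s := N)) (hch.mono Set.inter_subset_left)
  by_cases hsmall : ∃ x y : K, ultrametricBall x y ∈ N ∧ 0 < ArchimedeanClass.mk (x - y)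
  · obtain ⟨x, y, hB, hxy⟩ := hsmall
    refine ⟨z, fun B hBN ↦ ?_⟩
    rcases hNb hBN with hBu | ⟨q, r, hr, rfl⟩
    · exact hz B ⟨hBN, hBu⟩
    · exact (hch.total hBN hB).resolve_left (not_orderBall_subset_ultrametricBall hr hxy)
        (hz _ ⟨hB, x, y, rfl⟩)
  rcases (N ∩ rationalOrderBalls K).eq_empty_or_nonempty with hemp | hne
  · refine ⟨z, fun B hBN ↦ hz B ⟨hBN, (hNb hBN).resolve_right fun hBo ↦ ?_⟩⟩
    exact (hemp.subset ⟨hBN, hBo⟩ : B ∈ (∅ : Set (Set K)))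
  obtain ⟨w, hw⟩ := exists_forall_mem_of_isChain_rationalOrderBalls f
    (Set.inter_subset_right (s := N)) (hch.mono Set.inter_subset_left) hne
  refine ⟨w, fun B hBN ↦ ?_⟩
  rcases hNb hBN with ⟨x, y, rfl⟩ | hBo
  · obtain ⟨B', hB', q, r, hr, rfl⟩ := hne
    have hxy : ArchimedeanClass.mk (x - y) ≤ 0 := by
      by_contra! hc
      exact hsmall ⟨x, y, hBN, hc⟩
    exact (hch.total hBN hB').resolve_left (not_ultrametricBall_subset_orderBall hxy)
      (hw _ ⟨hB', q, r, hr, rfl⟩)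
  · exact hw B ⟨hBN, hBo⟩

end HybridBallSpace

theorem theorem9p10 (K : Type u) [Field K] [LinearOrder K] [IsStrictOrderedRing K] :
    IsoRealPowerSeriesField K ↔ (hybridBallSpace K).SphericallyComplete :=
  ⟨fun h ↦ h.sphericallyComplete, fun h ↦ h.isoRealPowerSeriesField⟩
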